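/- Let $R$ be a commutative Noetherian ring and $H$ a Hopf $R$-algebra with a twisted antipode $\overline{S}$, i.e. an $R$-linear map $\overline S:H\to H$ with $\sum \overline{S}(h_2)h_1=\varepsilon(h)1_H=\sum h_2\overline{S}(h_1)$ for all $h\in H$. Let $B$ be a right $H$-comodule algebra with coaction $b\mapsto\sum b_{<0>}\otimes b_{<1>}$, put $A:=B^{coH}=\{b\in B\mid \sum b_{<0>}\otimes b_{<1>}=b\otimes 1_H\}$, and assume that $B/A$ is cleft with invertible total integral $\theta$: an $H$-colinear map $\theta:H\to B$ with $\theta(1_H)=1_B$ that has an inverse $\theta^{-1}$ for the convolution product of $\mathrm{Hom}_R(H,B)$. Let $H^*=\mathrm{Hom}_R(H,R)$ carry the convolution product $\star$ and the right $H$-action $(fh)(k)=f(hk)$, and let $U\subseteq H^*$ be a right $H$-module subalgebra, i.e. an $R$-submodule closed under $\star$ and under the $H$-action (it may or may not contain the unity $\varepsilon$ of $H^*$). Let $B\#U$ be the $R$-module $B\otimes_R U$ with the multiplication $$(b\#f)(b'\#f')=\sum b\,b'_{<0>}\#(f\,b'_{<1>})\star f',$$ and let $H\#U$ be the case $B=H$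 with coaction $\Delta_H$. Write $f\rightharpoonup k=\sum k_1f(k_2)$ and $k\leftharpoonup g=\sum g(k_1)k_2$ for $f,g\in H^*$, $k\in H$. Assume that there is a right $H$-submodule $V\subseteq H^*$ such that: 1. for all $h\in H$, $a\in A$ the maps $\widetilde\varphi(h\otimes a),\widetilde\psi(h\otimes a):H\to A$, $$\widetilde\varphi(h\otimes a)(x)=\sum\theta(\overline S(x_2))\,a\,\theta(h_1)\,\theta^{-1}(\overline S(x_1)h_2),$$ $$\widetilde\psi(h\otimes a)(x)=\sum\theta^{-1}(\overline S(x_3))\,a\,\theta(\overline S(x_2)h_1)\,\theta^{-1}(x_4\overline S(x_1)h_2),$$ lie in the image of the canonical map $J:A\otimes_RV\to\mathrm{Hom}_R(H,A)$, $J(a\otimes g)(x)=g(x)a$; 2. $(V,U)$ satisfies the RL-condition: for every $g\in V$ there are finitely many $(h_j,g_j)\in H\times U$ with $k\leftharpoonup g=\sum_j h_j(g_j\rightharpoonup k)$ for all $k\in H$. For an $R$-module $N$, a submodule $K\subseteq M$ is called $N$-pure if $K\otimes_RN\to M\otimes_RN$ is injective, and pure if it is $N$-pure for all $N$. Let $R^H$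 be the $R$-module of all functions $H\to R$, and let "dense" refer to the finite topology. Then: (a) If $U\subset R^H$ is $A\otimes_RH$-pure, there is an $R$-algebra isomorphism $B\#U\simeq A\otimes_R(H\#U)$. (b) If moreover ${}_RH$ is projective and $U\subseteq H^*$ is dense, there are a dense $R$-subalgebra $\mathcal L\subseteq\mathrm{End}_R(H)$ and an $R$-algebra isomorphism $B\#U\simeq A\otimes_R\mathcal L$. If $\varepsilon\in U$, then $B\#U$ and $H\#U$ have the unities $1_B\#\varepsilon$ and $1_H\#\varepsilon$, the isomorphisms preserve unities, and $\mathrm{id}_H\in\mathcal L$. Let $H^\circ=\{f\in H^*\mid HfH \text{ is a finitely generated } R\text{-module}\}$, where $(hfk)(b)=f(kbh)$. (c) The purity assumption in (a) holds if $H^\circ\subset R^H$ is pure and $U\subseteq H^\circ$ is an $R$-subbialgebra (a subalgebra with unity $\varepsilon$ that is pure in $H^\circ$ and satisfies $\Delta(U)\subseteq U\otimes_R U$, where $\Delta(f)(h\otimes k)=f(hk)$). (d) The density assumption in (b) holds if $R$ is a quasi-Frobenius ring, $\bigcap_{f\in H^\circ}\mathrm{Ker} f=0$ ($H$ is residually finite),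 and $U\subseteq H^\circ$ is dense. -/

import Mathlib

open scoped TensorProduct

noncomputable section

namespace CleftDuality

universe u v w x

/-! ### Comodule algebras and coinvariants -/

/-- A right `H`-comodule algebra `B` over a bialgebra `H`: a coassociative, counital coaction
`ϱ : B → B ⊗ H` which is a morphism of `R`-algebras. -/
class RightComoduleAlgebra (R : Type u) (H : Type v) (B : Type w) [CommRing R] [Ring H]
    [Bialgebra R H] [Ring B] [Algebra R B] where
  /-- the coaction `b ↦ ∑ b₀ ⊗ b₁` -/
  coaction : B →ₐ[R] B ⊗[R] H
  coassoc : (TensorProduct.assoc R B H H).toLinearMap ∘ₗ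
      coaction.toLinearMap.rTensor H ∘ₗ coaction.toLinearMap =
    (Coalgebra.comul (R := R) (A := H)).lTensor B ∘ₗ coaction.toLinearMap
  counit : (TensorProduct.rid R B).toLinearMap ∘ₗ
      (Coalgebra.counit (R := R) (A := H)).lTensor B ∘ₗ coaction.toLinearMap = LinearMap.id

/-- `H` is a right comodule algebra over itself through its comultiplication. -/
instance selfComoduleAlgebra (R : Type u) (H : Type v) [CommRing R] [Ring H] [Bialgebra R H] :
    RightComoduleAlgebra R H H where
  coaction := Bialgebra.comulAlgHom R H
  coassoc := Coalgebra.coassoc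
  counit := by
    ext h
    simp

/-- The subalgebra of coinvariants `B^{co H} = {b | ϱ b = b ⊗ 1}`. -/
def coinvariants (R : Type u) (H : Type v) (B : Type w) [CommRing R] [Ring H] [Bialgebra R H]
    [Ring B] [Algebra R B] [RightComoduleAlgebra R H B] : Subalgebra R B :=
  AlgHom.equalizer (RightComoduleAlgebra.coaction (R := R) (H := H) (B := B))
    Algebra.TensorProduct.includeLeft

section Dual

variable (R : Type u) (H : Type v) [CommRing R] [Ring H] [Bialgebra R H]

/-! ### The dual `H^*` with its convolution product and its right regular `H`-action -/

/-- Convolution on `H^*`: `(f ⋆ g)(h) = ∑ f(h₁) g(h₂)`. -/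
def conv : Module.Dual R H →ₗ[R] Module.Dual R H →ₗ[R] Module.Dual R H :=
  LinearMap.mk₂ R (fun f g => (WithConv.toConv f * WithConv.toConv g).ofConv)
    (fun f f' g => by simp [add_mul]) (fun c f g => by simp [smul_mul_assoc])
    (fun f g g' => by simp [mul_add]) (fun c f g => by simp [mul_smul_comm])

/-- The right regular action of `H` on `H^*`: `(f h)(k) = f(h k)`. -/
def regAct : Module.Dual R H →ₗ[R] H →ₗ[R] Module.Dual R H :=
  LinearMap.mk₂ R (fun f h => f ∘ₗ LinearMap.mulLeft R h)
    (fun f f' h => by ext; simp) (fun c f h => by ext; simp)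
    (fun f h h' => by ext; simp [add_mul]) (fun c f h => by ext; simp)

theorem conv_apply (f g : Module.Dual R H) (h : H) {ι : Type*}
    (r : Coalgebra.Repr R h ι) :
    conv R H f g h = ∑ i ∈ r.index, f (r.left i) * g (r.right i) :=
  r.convMul_apply (WithConv.toConv f) (WithConv.toConv g)

@[simp] theorem regAct_apply (f : Module.Dual R H) (h k : H) :
    regAct R H f h k = f (h * k) := rfl

/-- A right `H`-submodule of `H^*`. -/
def IsRightSubmodule (V : Submodule R (Module.Dual R H)) : Prop :=
  ∀ f ∈ V, ∀ h : H, regAct R H f h ∈ V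

/-- A right `H`-module subalgebra `U ⊆ H^*`: an `R`-submodule closed under convolution and under
the right regular `H`-action. It is not required to contain the unity `ε` of `H^*`. -/
structure ModuleSubalgebra extends Submodule R (Module.Dual R H) where
  conv_mem' : ∀ {f g}, f ∈ carrier → g ∈ carrier → conv R H f g ∈ carrier
  regAct_mem' : ∀ {f} (h : H), f ∈ carrier → regAct R H f h ∈ carrier

/-- `f ⇀ k = ∑ k₁ f(k₂)`. -/
def leftHit : Module.Dual R H →ₗ[R] Module.End R H where
  toFun f := (TensorProduct.rid R H).toLinearMap ∘ₗ f.lTensor H ∘ₗ Coalgebra.comul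
  map_add' f g := by simp [LinearMap.lTensor_add, LinearMap.add_comp, LinearMap.comp_add]
  map_smul' c f := by simp [LinearMap.lTensor_smul, LinearMap.smul_comp, LinearMap.comp_smul]

/-- `k ↼ g = ∑ g(k₁) k₂`. -/
def rightHit : Module.Dual R H →ₗ[R] Module.End R H where
  toFun f := (TensorProduct.lid R H).toLinearMap ∘ₗ f.rTensor H ∘ₗ Coalgebra.comul
  map_add' f g := by simp [LinearMap.rTensor_add, LinearMap.add_comp, LinearMap.comp_add]
  map_smul' c f := by simp [LinearMap.rTensor_smul, LinearMap.smul_comp, LinearMap.comp_smul]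

theorem leftHit_apply (f : Module.Dual R H) (k : H) {ι : Type*}
    (r : Coalgebra.Repr R k ι) :
    leftHit R H f k = ∑ i ∈ r.index, f (r.right i) • r.left i := by
  simp [leftHit, ← r.eq]

theorem rightHit_apply (f : Module.Dual R H) (k : H) {ι : Type*}
    (r : Coalgebra.Repr R k ι) :
    rightHit R H f k = ∑ i ∈ r.index, f (r.left i) • r.right i := by
  simp [rightHit, ← r.eq]

/-- `λ : H ⊗ U → End_R(H)`, `h ⊗ g ↦ [k ↦ h (g ⇀ k)]`. -/
def lam (U : Submodule R (Module.Dual R H)) : H ⊗[R] U →ₗ[R] Module.End R H :=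
  TensorProduct.lift
    ((LinearMap.mul R (Module.End R H)).compl₁₂ (LinearMap.mul R H) (leftHit R H ∘ₗ U.subtype))

@[simp] theorem lam_tmul (U : Submodule R (Module.Dual R H)) (h : H) (g : U)
    (k : H) : lam R H U (h ⊗ₜ g) k = h * leftHit R H g k := rfl

/-- The RL-condition for `(V, U)`: every `k ↦ k ↼ g`, `g ∈ V`, has the form
`k ↦ ∑ hⱼ (gⱼ ⇀ k)` with `hⱼ ∈ H`, `gⱼ ∈ U`, that is `ρ(V) ⊆ λ(H # U)`. -/
def RLCondition (V U : Submodule R (Module.Dual R H)) : Prop :=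
  V.map (rightHit R H) ≤ LinearMap.range (lam R H U)

/-- `S' : H → H` is a twisted antipode of `H`, that is, an antipode of `H^{op}`:
`∑ h₂ S'(h₁) = ε(h) 1 = ∑ S'(h₂) h₁`. -/
structure IsTwistedAntipode (S' : H →ₗ[R] H) : Prop where
  mul_left : LinearMap.mul' R H ∘ₗ S'.lTensor H ∘ₗ (TensorProduct.comm R H H).toLinearMap ∘ₗ
      Coalgebra.comul = Algebra.linearMap R H ∘ₗ Coalgebra.counit
  mul_right : LinearMap.mul' R H ∘ₗ S'.rTensor H ∘ₗ (TensorProduct.comm R H H).toLinearMap ∘ₗ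
      Coalgebra.comul = Algebra.linearMap R H ∘ₗ Coalgebra.counit

end Dual

/-! ### The right smash product `B # U` -/

section Smash

variable (R : Type u) (H : Type v) (B : Type w) [CommRing R] [Ring H] [Bialgebra R H]
  [Ring B] [Algebra R B] [RightComoduleAlgebra R H B] (U : ModuleSubalgebra R H)

/-- The bilinear map `(h, f') ↦ (f h) ⋆ f'`, depending linearly on `f ∈ U`. -/
def twistConv : U.toSubmodule →ₗ[R] H →ₗ[R] U.toSubmodule →ₗ[R] U.toSubmodule where
  toFun f := LinearMap.mk₂ R
    (fun h f' => ⟨conv R H (regAct R H f h) f', U.conv_mem' (U.regAct_mem' h f.2) f'.2⟩)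
    (fun _ _ _ => by ext1; simp) (fun _ _ _ => by ext1; simp)
    (fun _ _ _ => by ext1; simp) (fun _ _ _ => by ext1; simp)
  map_add' _ _ := by ext1; ext1; ext1; simp
  map_smul' _ _ := by ext1; ext1; ext1; simp

/-- The multiplication `(b # f)(b' # f') = ∑ b b'₀ # (f b'₁) ⋆ f'` on `B ⊗ U`. -/
def smashMul : B ⊗[R] U.toSubmodule →ₗ[R] B ⊗[R] U.toSubmodule →ₗ[R] B ⊗[R] U.toSubmodule :=
  TensorProduct.lift
    (((TensorProduct.mapBilinear (.id R) B (H ⊗[R] U.toSubmodule) B U.toSubmodule).compl₁₂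
        (LinearMap.mul R B)
        ((TensorProduct.uncurry (.id R) H U.toSubmodule U.toSubmodule) ∘ₗ twistConv R H U)).compr₂
      (LinearMap.lcomp R (B ⊗[R] U.toSubmodule)
        ((TensorProduct.assoc R B H U.toSubmodule).toLinearMap ∘ₗ
          (RightComoduleAlgebra.coaction (R := R) (H := H) (B := B)).toLinearMap.rTensor
            U.toSubmodule)))

/-- The algebra `B # U`: the `R`-module `B ⊗ U` with the multiplication `smashMul`. -/
def Smash : Type max u v w := B ⊗[R] U.toSubmodule

instance : AddCommGroup (Smash R H B U) := inferInstanceAs (AddCommGroup (B ⊗[R] U.toSubmodule))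

instance : Module R (Smash R H B U) := inferInstanceAs (Module R (B ⊗[R] U.toSubmodule))

variable {R H B U} in
/-- The element `b # f` of `B # U`. -/
def Smash.mk (b : B) (f : U.toSubmodule) : Smash R H B U := b ⊗ₜ[R] f

instance : NonUnitalNonAssocRing (Smash R H B U) where
  mul x y := smashMul R H B U x y
  left_distrib x y z := (smashMul R H B U x).map_add y z
  right_distrib x y z := LinearMap.map_add₂ (smashMul R H B U) x y z
  zero_mul x := LinearMap.map_zero₂ (smashMul R H B U) x
  mul_zero x := (smashMul R H B U x).map_zero

instance : IsScalarTower R (Smash R H B U) (Smash R H B U) where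
  smul_assoc c x y := LinearMap.map_smul₂ (smashMul R H B U) c x y

instance : SMulCommClass R (Smash R H B U) (Smash R H B U) where
  smul_comm c x y := ((smashMul R H B U x).map_smul c y).symm

theorem Smash.mk_mul_mk {ι : Type*} (b b' : B) (f f' : U.toSubmodule) (s : Finset ι) (b₀ : ι → B)
    (b₁ : ι → H)
    (hb : RightComoduleAlgebra.coaction (R := R) (H := H) b' = ∑ i ∈ s, b₀ i ⊗ₜ[R] b₁ i) :
    (Smash.mk b f * Smash.mk b' f' : Smash R H B U) =
      ∑ i ∈ s, Smash.mk (b * b₀ i) (twistConv R H U f (b₁ i) f') := by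
  change smashMul R H B U (b ⊗ₜ f) (b' ⊗ₜ f') = ∑ i ∈ s, (b * b₀ i) ⊗ₜ[R] _
  simp [smashMul, hb, TensorProduct.sum_tmul]

end Smash

/-! ### Cleft extensions -/

section Cleft

variable {R : Type u} {H : Type v} {B : Type w} [CommRing R] [Ring H] [Bialgebra R H]
  [Ring B] [Algebra R B]

/-- A total integral: an `H`-colinear map `θ : H → B` with `θ 1 = 1`. -/
structure IsTotalIntegral [RightComoduleAlgebra R H B] (θ : H →ₗ[R] B) : Prop where
  colinear : (RightComoduleAlgebra.coaction (R := R) (H := H) (B := B)).toLinearMap ∘ₗ θ =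
    θ.rTensor H ∘ₗ Coalgebra.comul
  map_one : θ 1 = 1

/-- `θ` and `θ'` are inverse to each other in the convolution algebra `Hom_R(H, B)`. -/
def IsConvInverse (θ θ' : H →ₗ[R] B) : Prop :=
  WithConv.toConv θ * WithConv.toConv θ' = 1 ∧ WithConv.toConv θ' * WithConv.toConv θ = 1

/-- `φ̃(h ⊗ a)(x) = ∑ θ(S'(x₂)) a θ(h₁) θ⁻¹(S'(x₁) h₂)`. -/
def phiTilde (θ θ' : H →ₗ[R] B) (S' : H →ₗ[R] H) (h : H) (a : B) : H →ₗ[R] B :=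
  LinearMap.mul' R B ∘ₗ
    TensorProduct.map
      (LinearMap.mul' R B ∘ₗ TensorProduct.map (LinearMap.mulRight R a ∘ₗ θ ∘ₗ S') θ)
      (θ' ∘ₗ LinearMap.mul' R H ∘ₗ S'.rTensor H) ∘ₗ
    (TensorProduct.tensorTensorTensorComm R H H H H).toLinearMap ∘ₗ
    TensorProduct.map ((TensorProduct.comm R H H).toLinearMap ∘ₗ Coalgebra.comul)
      Coalgebra.comul ∘ₗ
    (TensorProduct.mk R H H).flip h

/-- The linear map `x ↦ ∑ (x₃ ⊗ x₂) ⊗ (x₄ ⊗ x₁)`. -/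
def comul₃₂₄₁ (R : Type u) (H : Type v) [CommRing R] [Ring H] [Bialgebra R H] :
    H →ₗ[R] (H ⊗[R] H) ⊗[R] (H ⊗[R] H) :=
  (TensorProduct.tensorTensorTensorComm R H H H H).toLinearMap ∘ₗ
    TensorProduct.map Coalgebra.comul
      ((TensorProduct.comm R H H).toLinearMap ∘ₗ Coalgebra.comul) ∘ₗ
    (TensorProduct.comm R H H).toLinearMap ∘ₗ Coalgebra.comul

/-- `ψ̃(h ⊗ a)(x) = ∑ θ⁻¹(S'(x₃)) a θ(S'(x₂) h₁) θ⁻¹(x₄ S'(x₁) h₂)`. -/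
def psiTilde (θ θ' : H →ₗ[R] B) (S' : H →ₗ[R] H) (h : H) (a : B) : H →ₗ[R] B :=
  LinearMap.mul' R B ∘ₗ
    TensorProduct.map
      (LinearMap.mul' R B ∘ₗ
        TensorProduct.map (LinearMap.mulRight R a ∘ₗ θ' ∘ₗ S')
          (θ ∘ₗ LinearMap.mul' R H ∘ₗ S'.rTensor H) ∘ₗ
        (TensorProduct.assoc R H H H).toLinearMap)
      (θ' ∘ₗ LinearMap.mul' R H ∘ₗ (LinearMap.mul' R H ∘ₗ S'.lTensor H).rTensor H) ∘ₗ
    (TensorProduct.tensorTensorTensorComm R (H ⊗[R] H) (H ⊗[R] H) H H).toLinearMap ∘ₗ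
    TensorProduct.map (comul₃₂₄₁ R H) Coalgebra.comul ∘ₗ
    (TensorProduct.mk R H H).flip h

theorem phiTilde_apply (θ θ' : H →ₗ[R] B) (S' : H →ₗ[R] H) (h : H) (a : B) (x : H)
    {ι κ : Type*} (rx : Coalgebra.Repr R x ι) (rh : Coalgebra.Repr R h κ) :
    phiTilde θ θ' S' h a x = ∑ j ∈ rh.index, ∑ i ∈ rx.index,
      θ (S' (rx.right i)) * a * θ (rh.left j) * θ' (S' (rx.left i) * rh.right j) := by
  simp [phiTilde, ← rx.eq, ← rh.eq, TensorProduct.sum_tmul, TensorProduct.tmul_sum]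

theorem psiTilde_apply (θ θ' : H →ₗ[R] B) (S' : H →ₗ[R] H) (h : H) (a : B) (x : H)
    {ι κ μ ν : Type*} (rx : Coalgebra.Repr R x ι) (rh : Coalgebra.Repr R h κ)
    (r₁ : (i : ι) → Coalgebra.Repr R (rx.left i) μ)
    (r₂ : (i : ι) → Coalgebra.Repr R (rx.right i) ν) :
    psiTilde θ θ' S' h a x = ∑ j ∈ rh.index, ∑ i ∈ rx.index, ∑ l ∈ (r₁ i).index,
      ∑ m ∈ (r₂ i).index,
        θ' (S' ((r₂ i).left m)) * a * θ (S' ((r₁ i).right l) * rh.left j) *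
          θ' ((r₂ i).right m * S' ((r₁ i).left l) * rh.right j) := by
  simp [psiTilde, comul₃₂₄₁, ← rx.eq, ← rh.eq, ← (r₁ _).eq, ← (r₂ _).eq,
    TensorProduct.sum_tmul, TensorProduct.tmul_sum]

/-- The canonical map `J : A ⊗ V → Hom_R(H, A)`, `a ⊗ g ↦ [x ↦ g(x) a]`. -/
def evalMap (A : Subalgebra R B) (V : Submodule R (Module.Dual R H)) :
    A ⊗[R] V →ₗ[R] H →ₗ[R] A :=
  TensorProduct.lift ((LinearMap.smulRightₗ (R := R) (M := A) (M₂ := H)).flip.compl₂ V.subtype)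

@[simp] theorem evalMap_tmul (A : Subalgebra R B) (V : Submodule R (Module.Dual R H)) (a : A)
    (g : V) (x : H) : evalMap A V (a ⊗ₜ g) x = g.1 x • a := rfl

end Cleft
/-! ### Purity and density -/

section PureDense

variable {R : Type u} [CommRing R]

/-- `K ⊆ M` is `N`-pure: `K ⊗ N → M ⊗ N` is injective. -/
def IsPureFor {M : Type v} [AddCommGroup M] [Module R M] (N : Type w) [AddCommGroup N]
    [Module R N] (K : Submodule R M) : Prop :=
  Function.Injective (K.subtype.rTensor N)

/-- `K ⊆ M` is pure (in the sense of Cohn): it is `N`-pure for every `R`-module `N`. Since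
injectivity of `K ⊗ N → M ⊗ N` is detected on finitely generated `N`, the modules in the universe
of `R` suffice. -/
def IsPure {M : Type v} [AddCommGroup M] [Module R M] (K : Submodule R M) : Prop :=
  ∀ (N : Type u) [AddCommGroup N] [Module R N], IsPureFor N K

/-- `S ⊆ T` is dense in `T ⊆ Hom_R(M, N)` for the finite topology, that is, for the topology
induced from the product topology of `N^M` with `N` discrete. -/
def IsDenseIn {M : Type v} {N : Type w} [AddCommGroup M] [Module R M] [AddCommGroup N]
    [Module R N] (S T : Set (M →ₗ[R] N)) : Prop :=
  S ⊆ T ∧ ∀ f ∈ T, ∀ F : Finset M, ∃ s ∈ S, ∀ m ∈ F, s m = f m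

/-- A submodule of `H^*`, seen as a submodule of the module `R^H` of all functions `H → R`. -/
def asFunctions {H : Type v} [AddCommGroup H] [Module R H] (U : Submodule R (Module.Dual R H)) :
    Submodule R (H → R) :=
  U.map (LinearMap.ltoFun R H R R)

variable (R) in
/-- A (commutative) quasi-Frobenius ring: Artinian and self-injective. -/
def IsQuasiFrobenius : Prop := IsArtinianRing R ∧ Module.Injective R R

end PureDense

/-! ### The finite dual -/

section FiniteDual

variable (R : Type u) (H : Type v) [CommRing R] [Ring H] [Algebra R H]

/-- The `R`-submodule `H f H` of `H^*` generated by all `h f k : b ↦ f(k b h)`. -/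
def biSpan (f : Module.Dual R H) : Submodule R (Module.Dual R H) :=
  Submodule.span R
    (Set.range fun p : H × H => f ∘ₗ LinearMap.mulLeft R p.2 ∘ₗ LinearMap.mulRight R p.1)

variable {R H} in
theorem biSpan_le_of {f g g' : Module.Dual R H} (c c' : R) (hf : f = c • g + c' • g') :
    biSpan R H f ≤ biSpan R H g ⊔ biSpan R H g' := by
  subst hf
  refine Submodule.span_le.2 ?_
  rintro _ ⟨p, rfl⟩
  have h₁ : g ∘ₗ LinearMap.mulLeft R p.2 ∘ₗ LinearMap.mulRight R p.1 ∈ biSpan R H g :=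
    Submodule.subset_span ⟨p, rfl⟩
  have h₂ : g' ∘ₗ LinearMap.mulLeft R p.2 ∘ₗ LinearMap.mulRight R p.1 ∈ biSpan R H g' :=
    Submodule.subset_span ⟨p, rfl⟩
  exact Submodule.add_mem_sup (Submodule.smul_mem _ c h₁) (Submodule.smul_mem _ c' h₂)

/-- The finite dual `H° = {f ∈ H^* | H f H is a finitely generated R-module}`, for `R`
Noetherian. -/
def finiteDual [IsNoetherianRing R] : Submodule R (Module.Dual R H) where
  carrier := {f | (biSpan R H f).FG}
  zero_mem' := by
    have h : biSpan R H (0 : Module.Dual R H) = ⊥ := by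
      simp [biSpan]
    simpa [h] using Submodule.fg_bot
  add_mem' {f g} hf hg :=
    Submodule.FG.of_le (Submodule.FG.sup hf hg) (biSpan_le_of 1 1 (by simp))
  smul_mem' c f hf :=
    Submodule.FG.of_le (Submodule.FG.sup hf hf) (biSpan_le_of c 0 (by simp))

variable {R H} in
@[simp] theorem mem_finiteDual [IsNoetherianRing R] {f : Module.Dual R H} :
    f ∈ finiteDual R H ↔ (biSpan R H f).FG := Iff.rfl

/-- `H` is an `α`-algebra (a Hopf `α`-algebra, if it is a Hopf algebra): `H° ⊆ R^H` is pure. -/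
def IsAlphaAlgebra [IsNoetherianRing R] : Prop := IsPure (asFunctions (finiteDual R H))

/-- `H` is residually finite: the functionals in `H°` separate the elements of `H` from `0`. -/
def IsResiduallyFinite [IsNoetherianRing R] : Prop :=
  ∀ h : H, (∀ f ∈ finiteDual R H, f h = 0) → h = 0

end FiniteDual

/-- `U` is an `R`-subbialgebra of `H°`: a subalgebra containing the unity `ε`, pure in `H°`, such
that for `f ∈ U` the element `Δ f`, characterized by `(Δ f)(h ⊗ k) = f(h k)`, lies in `U ⊗ U`. -/
structure IsSubbialgebra (R : Type u) (H : Type v) [CommRing R] [IsNoetherianRing R] [Ring H]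
    [Bialgebra R H] (U : ModuleSubalgebra R H) : Prop where
  le : U.toSubmodule ≤ finiteDual R H
  pure : IsPure (R := R) (M := finiteDual R H) (U.toSubmodule.submoduleOf (finiteDual R H))
  counit_mem : Coalgebra.counit ∈ U.toSubmodule
  comul_mem : ∀ f ∈ U.toSubmodule, ∃ t : U.toSubmodule ⊗[R] U.toSubmodule,
    TensorProduct.dualDistrib R H H
      (TensorProduct.map U.toSubmodule.subtype U.toSubmodule.subtype t) = f ∘ₗ LinearMap.mul' R H

end CleftDuality
end

/-! Put η = θ⁻¹ ∘ S'. This map is colinear, and h ⊗ a ↦ η(h) a is an isomorphism H ⊗ A ≅ B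
(`normalBasisMap_bijective`). The algebra B # U acts on B by (b # f) c = b (f ⇀ c), and A ⊗ (H # U)
acts on H ⊗ A factor by factor. Both actions are linear for right multiplication by A, so they are
determined by their values at k ⊗ 1, that is, by the maps `smashEval` and `tensorEval` into Hom(H,
B) and Hom(H, H ⊗ A). If both are injective and have the same image in Hom(H, B), the resulting
linear bijection intertwines the two actions and is therefore multiplicative
(`exists_nonUnitalAlgHom`).

Injectivity: convolving in reversed order with θ ∘ S', respectively S', turns both maps into the
evaluation U ⊗ N → Hom(H, N) (`sw_smashEval_mul`, `sw_rTensor_tensorEval`). That evaluation is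
injective because U is N-pure in R^H and N ⊗ R^H → N^H is injective over a Noetherian ring.

Equality of images (`range_smashEval`): φ̃ and ψ̃ are the kernels that rewrite k ↦ a θ(h) η(k) by
terms η(y₂) φ̃(y₁), and k ↦ η(hk) a by terms ψ̃(y₁) θ(⋯) (`sw_sw_mul_phiTilde`,
`sw_sw_psiTilde_mul`). If they come from A ⊗ V, the functionals in V enter through y ↼ g, and the
RL-condition replaces these by elements of λ(H # U).

For (b), the algebra 𝓛 is the image of λ, which is dense by a dual basis argument. Part (c) composes
two pure inclusions; part (d) is the separation argument over a self-injective ring. -/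

noncomputable section

namespace CleftDuality

universe u v

set_option linter.unusedSectionVars false

/-! ### Sweedler sums -/

-- A Sweedler sum is independent of the chosen presentation only for multilinear summands;
-- `fun_prop` discharges these side conditions.
attribute [fun_prop] IsLinearMap

section Linear

variable {R : Type*} [CommRing R] {X Y Z M : Type*} [AddCommGroup X] [Module R X]
  [AddCommGroup Y] [Module R Y] [AddCommGroup Z] [Module R Z] [AddCommGroup M] [Module R M]

@[fun_prop]
theorem isLinearMap_id : IsLinearMap R fun x : X => x := ⟨fun _ _ => rfl, fun _ _ => rfl⟩

@[fun_prop]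
theorem isLinearMap_comp {g : Y → Z} {f : X → Y} (hg : IsLinearMap R g) (hf : IsLinearMap R f) :
    IsLinearMap R fun x => g (f x) :=
  ⟨fun x y => by rw [hf.map_add, hg.map_add], fun c x => by rw [hf.map_smul, hg.map_smul]⟩

@[fun_prop]
theorem isLinearMap_linearMap (L : X →ₗ[R] Y) {f : M → X} (hf : IsLinearMap R f) :
    IsLinearMap R fun x => L (f x) := isLinearMap_comp L.isLinear hf

@[fun_prop]
theorem isLinearMap_algHom {X Y : Type*} [Ring X] [Algebra R X] [Ring Y] [Algebra R Y]
    (L : X →ₐ[R] Y) {f : M → X} (hf : IsLinearMap R f) :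
    IsLinearMap R fun x => L (f x) := isLinearMap_comp L.toLinearMap.isLinear hf

@[fun_prop]
theorem isLinearMap_mul_const {B : Type*} [Ring B] [Algebra R B] {f : X → B}
    (hf : IsLinearMap R f) (b : B) : IsLinearMap R fun x => f x * b :=
  isLinearMap_comp (LinearMap.mulRight R b).isLinear hf

@[fun_prop]
theorem isLinearMap_const_mul {B : Type*} [Ring B] [Algebra R B] {f : X → B}
    (hf : IsLinearMap R f) (b : B) : IsLinearMap R fun x => b * f x :=
  isLinearMap_comp (LinearMap.mulLeft R b).isLinear hf

@[fun_prop]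
theorem isLinearMap_tmul_const {f : X → Y} (hf : IsLinearMap R f) (z : Z) :
    IsLinearMap R fun x => f x ⊗ₜ[R] z :=
  isLinearMap_comp (g := fun y => y ⊗ₜ[R] z) ((TensorProduct.mk R Y Z).flip z).isLinear hf

@[fun_prop]
theorem isLinearMap_const_tmul {f : X → Z} (hf : IsLinearMap R f) (y : Y) :
    IsLinearMap R fun x => y ⊗ₜ[R] f x :=
  isLinearMap_comp (g := fun z => y ⊗ₜ[R] z) (TensorProduct.mk R Y Z y).isLinear hf

@[fun_prop]
theorem isLinearMap_smul_const {f : X → R} (hf : IsLinearMap R f) (y : Y) :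
    IsLinearMap R fun x => f x • y :=
  isLinearMap_comp (LinearMap.toSpanSingleton R Y y).isLinear hf

@[fun_prop]
theorem isLinearMap_const_smul {f : X → Y} (hf : IsLinearMap R f) (c : R) :
    IsLinearMap R fun x => c • f x :=
  isLinearMap_comp (LinearMap.lsmul R Y c).isLinear hf

/-- A map of two variables that is linear in each of them. -/
structure IsBilin (R : Type*) [CommRing R] {X Y M : Type*} [AddCommGroup X] [Module R X]
    [AddCommGroup Y] [Module R Y] [AddCommGroup M] [Module R M] (φ : X → Y → M) : Prop where
  left : ∀ y, IsLinearMap R fun x => φ x y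
  right : ∀ x, IsLinearMap R fun y => φ x y

/-- The linear map on the tensor product that belongs to a bilinear map. -/
def IsBilin.lift {φ : X → Y → M} (h : IsBilin R φ) : X ⊗[R] Y →ₗ[R] M :=
  TensorProduct.lift (LinearMap.mk₂ R φ (fun x x' y => (h.left y).map_add x x')
    (fun c x y => (h.left y).map_smul c x) (fun x y y' => (h.right x).map_add y y')
    (fun c x y => (h.right x).map_smul c y))

@[simp] theorem IsBilin.lift_tmul {φ : X → Y → M} (h : IsBilin R φ) (x : X) (y : Y) :
    h.lift (x ⊗ₜ y) = φ x y := rfl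

/-- `∑ φ(xᵢ, yᵢ)` for a chosen presentation `t = ∑ xᵢ ⊗ yᵢ`. -/
def sw (t : X ⊗[R] Y) (φ : X → Y → M) : M :=
  ∑ i ∈ (TensorProduct.exists_finset t).choose, φ i.1 i.2

theorem sw_tmul_self (t : X ⊗[R] Y) : sw t (fun x y => x ⊗ₜ[R] y) = t :=
  (TensorProduct.exists_finset t).choose_spec.symm

theorem map_sw {F : Type*} [FunLike F Z M] [AddMonoidHomClass F Z M] (L : F)
    (t : X ⊗[R] Y) (φ : X → Y → Z) : L (sw t φ) = sw t fun x y => L (φ x y) :=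
  map_sum L _ _

theorem sw_eq_lift {φ : X → Y → M} (h : IsBilin R φ) (t : X ⊗[R] Y) : sw t φ = h.lift t := by
  conv_rhs => rw [← sw_tmul_self t, map_sw]
  rfl

theorem sw_apply (L : X ⊗[R] Y →ₗ[R] M) (t : X ⊗[R] Y) : sw t (fun x y => L (x ⊗ₜ y)) = L t := by
  conv_rhs => rw [← sw_tmul_self t, map_sw]

theorem sw_mul {B : Type*} [Ring B] (t : X ⊗[R] Y) (φ : X → Y → B) (b : B) :
    sw t φ * b = sw t fun x y => φ x y * b := Finset.sum_mul ..

theorem mul_sw {B : Type*} [Ring B] (t : X ⊗[R] Y) (φ : X → Y → B) (b : B) :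
    b * sw t φ = sw t fun x y => b * φ x y := Finset.mul_sum ..

theorem sw_tmul_right (t : X ⊗[R] Y) (φ : X → Y → M) (z : Z) :
    sw t φ ⊗ₜ[R] z = sw t fun x y => φ x y ⊗ₜ[R] z := TensorProduct.sum_tmul ..

theorem smul_sw (t : X ⊗[R] Y) (φ : X → Y → M) (c : R) :
    c • sw t φ = sw t fun x y => c • φ x y := Finset.smul_sum ..

theorem sw_smul (t : X ⊗[R] Y) (φ : X → Y → R) (z : M) :
    sw t φ • z = sw t fun x y => φ x y • z := Finset.sum_smul ..

theorem sw_comm {X' Y' : Type*} [AddCommGroup X'] [Module R X'] [AddCommGroup Y'] [Module R Y']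
    (t : X ⊗[R] Y) (t' : X' ⊗[R] Y') (φ : X → Y → X' → Y' → M) :
    (sw t fun x y => sw t' fun x' y' => φ x y x' y') =
      sw t' fun x' y' => sw t fun x y => φ x y x' y' := Finset.sum_comm

theorem sw_comm_three {X₁ Y₁ X₂ Y₂ : Type*} [AddCommGroup X₁] [Module R X₁] [AddCommGroup Y₁]
    [Module R Y₁] [AddCommGroup X₂] [Module R X₂] [AddCommGroup Y₂] [Module R Y₂]
    (t : X ⊗[R] Y) (t₁ : X₁ ⊗[R] Y₁) (t₂ : X₂ ⊗[R] Y₂) (φ : X → Y → X₁ → Y₁ → X₂ → Y₂ → M) :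
    (sw t fun x y => sw t₁ fun x₁ y₁ => sw t₂ fun x₂ y₂ => φ x y x₁ y₁ x₂ y₂) =
      sw t₂ fun x₂ y₂ => sw t₁ fun x₁ y₁ => sw t fun x y => φ x y x₁ y₁ x₂ y₂ := by
  rw [sw_comm t t₁, sw_comm t₂ t₁]
  exact congrArg _ (funext₂ fun _ _ => sw_comm ..)

@[fun_prop]
theorem isLinearMap_sw_const (t : X ⊗[R] Y) {φ : Z → X → Y → M}
    (h : ∀ x y, IsLinearMap R fun z => φ z x y) : IsLinearMap R fun z => sw t (φ z) :=
  ⟨fun a b => by simp only [sw, (h _ _).map_add, Finset.sum_add_distrib],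
    fun a b => by simp only [sw, (h _ _).map_smul, Finset.smul_sum]⟩

@[fun_prop]
theorem isLinearMap_sw {φ : X → Y → M} (h₁ : ∀ y, IsLinearMap R fun x => φ x y)
    (h₂ : ∀ x, IsLinearMap R fun y => φ x y) {g : Z → X ⊗[R] Y} (hg : IsLinearMap R g) :
    IsLinearMap R fun z => sw (g z) φ := by
  simp only [sw_eq_lift (R := R) ⟨h₁, h₂⟩]
  fun_prop

@[simp] theorem sw_tmul {φ : X → Y → M} (x : X) (y : Y)
    (h₁ : ∀ y, IsLinearMap R fun x => φ x y := by fun_prop)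
    (h₂ : ∀ x, IsLinearMap R fun y => φ x y := by fun_prop) : sw (x ⊗ₜ[R] y) φ = φ x y := by
  rw [sw_eq_lift ⟨h₁, h₂⟩, IsBilin.lift_tmul]

theorem sw_sw {X' Y' : Type*} [AddCommGroup X'] [Module R X'] [AddCommGroup Y'] [Module R Y']
    (t : X ⊗[R] Y) (g : X → Y → X' ⊗[R] Y') {φ : X' → Y' → M}
    (h₁ : ∀ y, IsLinearMap R fun x => φ x y := by fun_prop)
    (h₂ : ∀ x, IsLinearMap R fun y => φ x y := by fun_prop) :
    sw (sw t g) φ = sw t fun x y => sw (g x y) φ := by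
  simp only [sw_eq_lift ⟨h₁, h₂⟩, map_sw]

/-- Common source of the coassociativity rules for Δ and for the coaction. -/
theorem sw_reassoc {P Q S : Type*} [AddCommGroup P] [Module R P] [AddCommGroup Q] [Module R Q]
    [AddCommGroup S] [Module R S] {t : X ⊗[R] S} {t' : P ⊗[R] Y} {D : X →ₗ[R] P ⊗[R] Q}
    {E : Y →ₗ[R] Q ⊗[R] S}
    (h : TensorProduct.assoc R P Q S (D.rTensor S t) = E.lTensor P t') (f : P → Q → S → M)
    (h₁ : ∀ q s, IsLinearMap R fun p => f p q s) (h₂ : ∀ p s, IsLinearMap R fun q => f p q s)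
    (h₃ : ∀ p q, IsLinearMap R fun s => f p q s) :
    (sw t fun x s => sw (D x) fun p q => f p q s) =
      sw t' fun p y => sw (E y) fun q s => f p q s := by
  have hb : ∀ p, IsBilin R (f p) := fun p => ⟨h₂ p, h₃ p⟩
  have hF : IsBilin R fun (p : P) (z : Q ⊗[R] S) => sw z (f p) :=
    ⟨fun z => by fun_prop, fun p => by fun_prop⟩
  have h' := congrArg hF.lift h
  have e₁ : ∀ x s, (sw (D x) fun p q => f p q s) =
      hF.lift (TensorProduct.assoc R P Q S (D x ⊗ₜ s)) := by
    intro x s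
    refine Eq.trans ?_ (sw_apply (hF.lift ∘ₗ (TensorProduct.assoc R P Q S).toLinearMap ∘ₗ
      (TensorProduct.mk R (P ⊗[R] Q) S).flip s) (D x))
    refine congrArg _ (funext₂ fun p q => ?_)
    exact (sw_tmul q s (h₂ p) (h₃ p)).symm
  simp only [e₁]
  exact (sw_apply (hF.lift ∘ₗ (TensorProduct.assoc R P Q S).toLinearMap ∘ₗ D.rTensor S) t).trans
    (h'.trans (sw_apply (hF.lift ∘ₗ E.lTensor P) t').symm)

end Linear

/-! ### Sweedler calculus in coalgebras and bialgebras. -/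

section Coalgebra

variable {R : Type*} [CommRing R] {C Y Z M : Type*} [AddCommGroup C] [Module R C] [Coalgebra R C]
  [AddCommGroup Y] [Module R Y] [AddCommGroup Z] [Module R Z] [AddCommGroup M] [Module R M]

local notation "Δ" => Coalgebra.comul (R := R)
local notation "ε" => Coalgebra.counit (R := R)

theorem sw_assoc (c : C) (f : C → C → C → M)
    (h₁ : ∀ q s, IsLinearMap R fun p => f p q s := by fun_prop)
    (h₂ : ∀ p s, IsLinearMap R fun q => f p q s := by fun_prop)
    (h₃ : ∀ p q, IsLinearMap R fun s => f p q s := by fun_prop) :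
    (sw (Δ c) fun x y => sw (Δ x) fun p q => f p q y) =
      sw (Δ c) fun x y => sw (Δ y) fun p q => f x p q :=
  sw_reassoc (Coalgebra.coassoc_apply c) f h₁ h₂ h₃

theorem sw_counit_left (c : C) (g : C → M) (hg : IsLinearMap R g := by fun_prop) :
    (sw (Δ c) fun x y => ε x • g y) = g c := by
  have := congrArg (hg.mk' ∘ₗ (TensorProduct.lid R C).toLinearMap)
    (Coalgebra.rTensor_counit_comul (R := R) c)
  simp only [LinearMap.comp_apply, LinearEquiv.coe_coe, TensorProduct.lid_tmul, one_smul] at this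
  refine Eq.trans ?_ ((sw_apply (hg.mk' ∘ₗ (TensorProduct.lid R C).toLinearMap ∘ₗ
    Coalgebra.counit.rTensor C) (Δ c)).trans this)
  simp

theorem sw_counit_right (c : C) (g : C → M) (hg : IsLinearMap R g := by fun_prop) :
    (sw (Δ c) fun x y => ε y • g x) = g c := by
  have := congrArg (hg.mk' ∘ₗ (TensorProduct.rid R C).toLinearMap)
    (Coalgebra.lTensor_counit_comul (R := R) c)
  simp only [LinearMap.comp_apply, LinearEquiv.coe_coe, TensorProduct.rid_tmul, one_smul] at this
  refine Eq.trans ?_ ((sw_apply (hg.mk' ∘ₗ (TensorProduct.rid R C).toLinearMap ∘ₗ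
    Coalgebra.counit.lTensor C) (Δ c)).trans this)
  simp

/-- `∑ q(c₁, c₂) = ε(c) z` for all `c`. -/
def Collapses (R : Type*) [CommRing R] {C Z : Type*} [AddCommGroup C] [Module R C]
    [Coalgebra R C] [AddCommGroup Z] [Module R Z] (q : C → C → Z) (z : Z) : Prop :=
  ∀ c : C, sw (Coalgebra.comul (R := R) c) q = Coalgebra.counit (R := R) c • z

theorem Collapses.apply {q : C → C → Z} {z : Z} (h : Collapses R q z) (c : C) (F : Z → M)
    (hF : IsLinearMap R F := by fun_prop) :
    (sw (Δ c) fun x y => F (q x y)) = ε c • F z := by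
  rw [← hF.map_smul, ← h c]
  exact (map_sw hF.mk' (Δ c) q).symm

/-- The inner pair becomes a counit, which the remaining leg absorbs. -/
theorem Collapses.right {q : C → C → Z} {z : Z} (h : Collapses R q z) (c : C) (F : C → Z → M)
    (h₁ : ∀ z, IsLinearMap R fun c => F c z := by fun_prop)
    (h₂ : ∀ c, IsLinearMap R fun z => F c z := by fun_prop) :
    (sw (Δ c) fun x y => sw (Δ y) fun p r => F x (q p r)) = F c z := by
  rw [← sw_counit_right c (fun c => F c z)]
  exact congrArg _ (funext₂ fun x y => h.apply y (F x) (h₂ x))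

theorem Collapses.left {q : C → C → Z} {z : Z} (h : Collapses R q z) (c : C) (F : Z → C → M)
    (h₁ : ∀ z, IsLinearMap R fun c => F z c := by fun_prop)
    (h₂ : ∀ c, IsLinearMap R fun z => F z c := by fun_prop) :
    (sw (Δ c) fun x y => sw (Δ x) fun p r => F (q p r) y) = F z c := by
  rw [← sw_counit_left c (fun c => F z c)]
  exact congrArg _ (funext₂ fun x y => h.apply x (fun z => F z y) (h₂ y))

/-- Inverses for the reversed convolution are unique. -/
theorem eq_of_collapses {Q : Type*} [Ring Q] [Algebra R Q] {p q p' : C →ₗ[R] Q}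
    (h : Collapses R (fun x y => p y * q x) 1) (h' : Collapses R (fun x y => q y * p' x) 1) :
    p = p' := by
  ext c
  have e₁ := h.right c (fun x z => z * p' x)
  have e₂ := h'.left c (fun z x => p x * z)
  rw [one_mul] at e₁
  rw [mul_one] at e₂
  rw [← e₁, ← e₂]
  simpa only [mul_assoc] using sw_assoc c (fun x y z => p z * (q y * p' x))

theorem sw_one {H : Type*} [Ring H] [Bialgebra R H] {φ : H → H → M}
    (h₁ : ∀ y, IsLinearMap R fun x => φ x y := by fun_prop)
    (h₂ : ∀ x, IsLinearMap R fun y => φ x y := by fun_prop) :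
    sw (Δ (1 : H)) φ = φ 1 1 := by
  rw [Bialgebra.comul_one, Algebra.TensorProduct.one_def, sw_tmul]

theorem sw_tmul_mul {A B : Type*} [Ring A] [Algebra R A] [Ring B] [Algebra R B] (t t' : A ⊗[R] B)
    {φ : A → B → M}
    (h₁ : ∀ y, IsLinearMap R fun x => φ x y := by fun_prop)
    (h₂ : ∀ x, IsLinearMap R fun y => φ x y := by fun_prop) :
    sw (t * t') φ = sw t fun x y => sw t' fun x' y' => φ (x * x') (y * y') := by
  conv_lhs => rw [← sw_tmul_self t, ← sw_tmul_self t']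
  simp only [sw_mul, mul_sw, Algebra.TensorProduct.tmul_mul_tmul]
  rw [sw_comm]
  simp only [sw_sw t _ h₁ h₂, sw_sw t' _ h₁ h₂, sw_tmul _ _ h₁ h₂]

theorem sw_of_eq {X Y X' Y' : Type*} [AddCommGroup X] [Module R X] [AddCommGroup Y] [Module R Y]
    [AddCommGroup X'] [Module R X'] [AddCommGroup Y'] [Module R Y'] {t : X ⊗[R] Y}
    {s : X' ⊗[R] Y'} {f : X' → Y' → X} {g : X' → Y' → Y} (h : t = sw s fun x y => f x y ⊗ₜ g x y)
    {φ : X → Y → M} (h₁ : ∀ y, IsLinearMap R fun x => φ x y := by fun_prop)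
    (h₂ : ∀ x, IsLinearMap R fun y => φ x y := by fun_prop) :
    sw t φ = sw s fun x y => φ (f x y) (g x y) := by
  rw [h, sw_sw _ _ h₁ h₂]
  simp only [sw_tmul _ _ h₁ h₂]

theorem sw_comul_mul {H : Type*} [Ring H] [Bialgebra R H] (h k : H) {φ : H → H → M}
    (h₁ : ∀ y, IsLinearMap R fun x => φ x y := by fun_prop)
    (h₂ : ∀ x, IsLinearMap R fun y => φ x y := by fun_prop) :
    sw (Δ (h * k)) φ = sw (Δ h) fun x y => sw (Δ k) fun x' y' => φ (x * x') (y * y') := by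
  rw [Bialgebra.comul_mul, sw_tmul_mul]

end Coalgebra

/-! ### The twisted antipode is an anti-homomorphism of algebras and of coalgebras. -/

section TwistedAntipode

variable {R H M : Type*} [CommRing R] [Ring H] [Bialgebra R H] [AddCommGroup M] [Module R M]
  {S' : H →ₗ[R] H}

local notation "Δ" => Coalgebra.comul (R := R)
local notation "ε" => Coalgebra.counit (R := R)

namespace IsTwistedAntipode

theorem collapses_left (hS : IsTwistedAntipode R H S') : Collapses R (fun x y => y * S' x) 1 := by
  intro c
  have := LinearMap.congr_fun hS.mul_left c
  simp only [← LinearMap.comp_assoc] at this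
  rw [LinearMap.comp_apply, ← sw_apply] at this
  simpa [Algebra.algebraMap_eq_smul_one] using this

theorem collapses_right (hS : IsTwistedAntipode R H S') :
    Collapses R (fun x y => S' y * x) 1 := by
  intro c
  have := LinearMap.congr_fun hS.mul_right c
  simp only [← LinearMap.comp_assoc] at this
  rw [LinearMap.comp_apply, ← sw_apply] at this
  simpa [Algebra.algebraMap_eq_smul_one] using this

theorem map_one (hS : IsTwistedAntipode R H S') : S' 1 = 1 := by
  have := hS.collapses_right 1
  rw [sw_one] at this
  simpa using this

theorem counit (hS : IsTwistedAntipode R H S') (h : H) : ε (S' h) = ε h := by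
  have := hS.collapses_right.apply h (fun x => ε x)
  simp only [Bialgebra.counit_mul, Bialgebra.counit_one] at this
  rw [← sw_counit_left (R := R) h (fun h => ε (S' h))]
  simpa [mul_comm, smul_eq_mul] using this

/-- The sum ∑ S'(h₃k₃) h₂k₂ S'(k₁) S'(h₁) is evaluated in two ways: cancelling S'(h₃k₃) against h₂k₂
leaves S'(k) S'(h), while cancelling k₂ S'(k₁) and then h₂ S'(h₁) leaves S'(hk). -/
theorem map_mul (hS : IsTwistedAntipode R H S') (h k : H) : S' (h * k) = S' k * S' h := by
  have e₁ : (sw (Δ h) fun h₁ h' => sw (Δ k) fun k₁ k' => sw (Δ h') fun h₂ h₃ =>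
      sw (Δ k') fun k₂ k₃ => S' (h₃ * k₃) * (h₂ * k₂) * S' k₁ * S' h₁) = S' k * S' h := by
    have : ∀ h₁ k₁ h' k', (sw (Δ h') fun h₂ h₃ =>
      sw (Δ k') fun k₂ k₃ => S' (h₃ * k₃) * (h₂ * k₂) * S' k₁ * S' h₁) =
        ε h' • ε k' • (S' k₁ * S' h₁) := by
      intro h₁ k₁ h' k'
      have := hS.collapses_right.apply (h' * k') (fun x => x * S' k₁ * S' h₁)
      rw [sw_comul_mul] at this
      rw [this]
      simp [mul_smul]
    simp only [this]
    simp only [← smul_sw]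
    rw [sw_counit_right h (fun x => sw (Δ k) fun k₁ k' => ε k' • (S' k₁ * S' x)),
      sw_counit_right k (fun k₁ => S' k₁ * S' h)]
  rw [← e₁]
  symm
  have e₂ : ∀ h₁ h', (sw (Δ k) fun k₁ k' => sw (Δ h') fun h₂ h₃ =>
      sw (Δ k') fun k₂ k₃ => S' (h₃ * k₃) * (h₂ * k₂) * S' k₁ * S' h₁) =
      sw (Δ h') fun h₂ h₃ => S' (h₃ * k) * h₂ * S' h₁ := by
    intro h₁ h'
    rw [sw_comm]
    refine congrArg _ (funext₂ fun h₂ h₃ => ?_)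
    rw [← sw_assoc k (fun k₁ k₂ k₃ => S' (h₃ * k₃) * (h₂ * k₂) * S' k₁ * S' h₁)]
    have := hS.collapses_left.left k (fun z k₃ => S' (h₃ * k₃) * h₂ * z * S' h₁)
    simpa only [mul_assoc, mul_one, one_mul] using this
  simp only [e₂]
  rw [← sw_assoc h (fun h₁ h₂ h₃ => S' (h₃ * k) * h₂ * S' h₁)]
  have := hS.collapses_left.left h (fun z h₃ => S' (h₃ * k) * z)
  simpa only [mul_assoc, mul_one, one_mul] using this

/-- Both sides are inverse to Δ for the reversed convolution in Hom(H, H ⊗ H). -/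
theorem comul (hS : IsTwistedAntipode R H S') (h : H) :
    Δ (S' h) = sw (Δ h) fun x y => S' y ⊗ₜ S' x := by
  let p' : H →ₗ[R] H ⊗[R] H := (TensorProduct.map S' S' ∘ₗ (TensorProduct.comm R H H).toLinearMap)
    ∘ₗ Coalgebra.comul
  have hp' : ∀ h, p' h = sw (Δ h) fun x y => S' y ⊗ₜ S' x := by
    intro h
    rw [LinearMap.comp_apply, ← sw_apply]
    rfl
  rw [← hp']
  refine LinearMap.congr_fun (eq_of_collapses (p := Δ ∘ₗ S') (q := Δ) (p' := p') ?_ ?_) h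
  · intro c
    have := hS.collapses_right.apply c (fun x => Δ x)
    simpa using this
  · intro c
    simp only [hp']
    have e₁ : ∀ x y, Δ y * (sw (Δ x) fun x y => S' y ⊗ₜ[R] S' x) = sw (Δ x) fun x₁ x₂ =>
        sw (Δ y) fun y₁ y₂ => (y₁ * S' x₂) ⊗ₜ (y₂ * S' x₁) := by
      intro x y
      conv_lhs => rw [← sw_tmul_self (Δ y)]
      simp only [sw_mul, mul_sw, Algebra.TensorProduct.tmul_mul_tmul]
    simp only [e₁]
    rw [sw_assoc c (fun x₁ x₂ y => sw (Δ y) fun y₁ y₂ => (y₁ * S' x₂) ⊗ₜ[R] (y₂ * S' x₁))]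
    have e₂ : ∀ x₁ y, (sw (Δ y) fun x₂ y => sw (Δ y) fun y₁ y₂ =>
        (y₁ * S' x₂) ⊗ₜ[R] (y₂ * S' x₁)) = 1 ⊗ₜ (y * S' x₁) := by
      intro x₁ y
      rw [← sw_assoc y fun x₂ y₁ y₂ => (y₁ * S' x₂) ⊗ₜ[R] (y₂ * S' x₁)]
      exact hS.collapses_left.left y (fun z y₂ => z ⊗ₜ[R] (y₂ * S' x₁))
    simp only [e₂]
    exact hS.collapses_left.apply c (fun z => (1 : H) ⊗ₜ[R] z)

theorem sw_comul (hS : IsTwistedAntipode R H S') (h : H) {φ : H → H → M}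
    (h₁ : ∀ y, IsLinearMap R fun x => φ x y := by fun_prop)
    (h₂ : ∀ x, IsLinearMap R fun y => φ x y := by fun_prop) :
    sw (Δ (S' h)) φ = sw (Δ h) fun x y => φ (S' y) (S' x) := by
  rw [hS.comul, sw_sw _ _ h₁ h₂]
  simp only [sw_tmul _ _ h₁ h₂]

end IsTwistedAntipode

end TwistedAntipode

/-! ### Sweedler calculus for the coaction. -/

section Coaction

variable {R H B M : Type*} [CommRing R] [Ring H] [Bialgebra R H] [Ring B] [Algebra R B]
  [RightComoduleAlgebra R H B] [AddCommGroup M] [Module R M]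

local notation "Δ" => Coalgebra.comul (R := R)
local notation "ε" => Coalgebra.counit (R := R)
local notation "ϱ" => RightComoduleAlgebra.coaction (R := R) (H := H)

theorem sw_coaction_assoc (b : B) (f : B → H → H → M)
    (h₁ : ∀ q s, IsLinearMap R fun p => f p q s := by fun_prop)
    (h₂ : ∀ p s, IsLinearMap R fun q => f p q s := by fun_prop)
    (h₃ : ∀ p q, IsLinearMap R fun s => f p q s := by fun_prop) :
    (sw (ϱ b) fun x y => sw (ϱ x) fun p q => f p q y) =
      sw (ϱ b) fun x y => sw (Δ y) fun p q => f x p q :=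
  sw_reassoc (t := ϱ b) (t' := ϱ b) (D := (ϱ).toLinearMap) (E := Δ)
    (LinearMap.congr_fun (RightComoduleAlgebra.coassoc (R := R) (H := H) (B := B)) b) f h₁ h₂ h₃

theorem sw_coaction_counit (b : B) (g : B → M) (hg : IsLinearMap R g := by fun_prop) :
    (sw (ϱ b) fun x y => ε y • g x) = g b := by
  have := congrArg hg.mk' (LinearMap.congr_fun
    (RightComoduleAlgebra.counit (R := R) (H := H) (B := B)) b)
  refine Eq.trans ?_ ((sw_apply (hg.mk' ∘ₗ (TensorProduct.rid R B).toLinearMap ∘ₗ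
    Coalgebra.counit.lTensor B) (ϱ b)).trans this)
  simp

theorem coaction_coinvariant (a : coinvariants R H B) : ϱ (a : B) = (a : B) ⊗ₜ 1 := a.2

theorem Collapses.coaction {q : H → H → M} {z : M} {N : Type*} [AddCommGroup N] [Module R N]
    (h : Collapses R q z) (b : B) (F : B → M → N)
    (h₁ : ∀ z, IsLinearMap R fun c => F c z := by fun_prop)
    (h₂ : ∀ c, IsLinearMap R fun z => F c z := by fun_prop) :
    (sw (ϱ b) fun x y => sw (Δ y) fun p r => F x (q p r)) = F b z := by
  rw [← sw_coaction_counit (H := H) b (fun c => F c z)]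
  exact congrArg _ (funext₂ fun x y => h.apply y (F x) (h₂ x))

end Coaction

/-! ### Convolution inverses and their composites with the twisted antipode. -/

section ConvInverse

variable {R H B M : Type*} [CommRing R] [Ring H] [Bialgebra R H] [Ring B] [Algebra R B]
  [AddCommGroup M] [Module R M] {θ θinv : H →ₗ[R] B} {S' : H →ₗ[R] H}

theorem collapses_of_conv_eq_one {p q : H →ₗ[R] B}
    (h : WithConv.toConv p * WithConv.toConv q = 1) : Collapses R (fun x y => p x * q y) 1 := by
  intro c
  have := LinearMap.congr_fun (congrArg WithConv.ofConv h) c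
  have e : (WithConv.toConv p * WithConv.toConv q).ofConv c =
      LinearMap.mul' R B (TensorProduct.map p q (Coalgebra.comul c)) := rfl
  rw [e, ← LinearMap.comp_apply, ← sw_apply] at this
  simpa [Algebra.algebraMap_eq_smul_one] using this

theorem IsConvInverse.collapses_right (h : IsConvInverse θ θinv) :
    Collapses R (fun x y => θ x * θinv y) 1 := collapses_of_conv_eq_one h.1

theorem IsConvInverse.collapses_left (h : IsConvInverse θ θinv) :
    Collapses R (fun x y => θinv x * θ y) 1 := collapses_of_conv_eq_one h.2

/-- Since S' reverses Δ and preserves ε, θ ∘ S' and θ⁻¹ ∘ S' are inverse to each other for the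
reversed convolution. -/
theorem Collapses.comp_twistedAntipode {q : H → H → M} {z : M} (h : Collapses R q z)
    (hS : IsTwistedAntipode R H S') (h₁ : ∀ y, IsLinearMap R fun x => q x y := by fun_prop)
    (h₂ : ∀ x, IsLinearMap R fun y => q x y := by fun_prop) :
    Collapses R (fun x y => q (S' y) (S' x)) z := by
  intro c
  rw [← hS.sw_comul c h₁ h₂, h, hS.counit]

end ConvInverse

/-! ### The normal basis isomorphism H ⊗ A ≅ B. -/

section Cleft

variable {R H B M : Type*} [CommRing R] [Ring H] [Bialgebra R H] [Ring B] [Algebra R B]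
  [RightComoduleAlgebra R H B] [AddCommGroup M] [Module R M] {θ θinv : H →ₗ[R] B} {S' : H →ₗ[R] H}

local notation "Δ" => Coalgebra.comul (R := R)
local notation "ε" => Coalgebra.counit (R := R)
local notation "ϱ" => RightComoduleAlgebra.coaction (R := R) (H := H)

theorem IsTotalIntegral.coaction (hθ : IsTotalIntegral θ) (h : H) :
    ϱ (θ h) = sw (Δ h) fun x y => θ x ⊗ₜ y :=
  (LinearMap.congr_fun hθ.colinear h).trans (sw_apply (θ.rTensor H) (Δ h)).symm

theorem coaction_total_twistedAntipode (hθ : IsTotalIntegral θ) (hS : IsTwistedAntipode R H S')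
    (h : H) : ϱ (θ (S' h)) = sw (Δ h) fun x y => θ (S' y) ⊗ₜ S' x := by
  rw [hθ.coaction, hS.sw_comul]

/-- `θ⁻¹ ∘ S'` is colinear. -/
theorem coaction_inverse_twistedAntipode (hθ : IsTotalIntegral θ) (hinv : IsConvInverse θ θinv)
    (hS : IsTwistedAntipode R H S') (h : H) :
    ϱ (θinv (S' h)) = sw (Δ h) fun x y => θinv (S' x) ⊗ₜ y := by
  have hp' : ∀ h, ((θinv ∘ₗ S').rTensor H ∘ₗ Δ) h =
      sw (Δ h) fun x y => θinv (S' x) ⊗ₜ[R] y := fun h =>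
    (sw_apply ((θinv ∘ₗ S').rTensor H) (Δ h)).symm
  rw [← hp']
  -- Both sides are reversed convolution inverses of ϱ ∘ θ ∘ S', whose values are known from the
  -- colinearity of θ.
  refine LinearMap.congr_fun (eq_of_collapses (p := (ϱ).toLinearMap ∘ₗ θinv ∘ₗ S')
    (q := (ϱ).toLinearMap ∘ₗ θ ∘ₗ S') ?_ ?_) h
  · intro c
    have := (hinv.collapses_left.comp_twistedAntipode hS).apply c (fun x => ϱ x)
    simpa using this
  · intro c
    simp only [hp']
    have e₁ : ∀ x y, ((ϱ).toLinearMap ∘ₗ θ ∘ₗ S') y * (sw (Δ x) fun x y => θinv (S' x) ⊗ₜ[R] y) =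
        sw (Δ x) fun x₁ x₂ => sw (Δ y) fun y₁ y₂ => (θ (S' y₂) * θinv (S' x₁)) ⊗ₜ (S' y₁ * x₂) := by
      intro x y
      change ϱ (θ (S' y)) * _ = _
      rw [coaction_total_twistedAntipode hθ hS]
      simp only [sw_mul, mul_sw, Algebra.TensorProduct.tmul_mul_tmul]
    simp only [e₁]
    rw [sw_assoc c (fun x₁ x₂ y => sw (Δ y) fun y₁ y₂ =>
      (θ (S' y₂) * θinv (S' x₁)) ⊗ₜ[R] (S' y₁ * x₂))]
    have e₂ : ∀ x₁ y, (sw (Δ y) fun x₂ y => sw (Δ y) fun y₁ y₂ =>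
        (θ (S' y₂) * θinv (S' x₁)) ⊗ₜ[R] (S' y₁ * x₂)) = (θ (S' y) * θinv (S' x₁)) ⊗ₜ 1 := by
      intro x₁ y
      rw [← sw_assoc y fun x₂ y₁ y₂ => (θ (S' y₂) * θinv (S' x₁)) ⊗ₜ[R] (S' y₁ * x₂)]
      exact hS.collapses_right.left y (fun z y₂ => (θ (S' y₂) * θinv (S' x₁)) ⊗ₜ[R] z)
    simp only [e₂]
    exact (hinv.collapses_right.comp_twistedAntipode hS).apply c (fun z => z ⊗ₜ[R] (1 : H))

/-- The map `b ↦ ∑ θ(S'(b₁)) b₀`. -/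
def coinvariantPart (θ : H →ₗ[R] B) (S' : H →ₗ[R] H) : B →ₗ[R] B :=
  (show IsLinearMap R fun b : B => sw (ϱ b) fun x h => θ (S' h) * x by fun_prop).mk'

theorem coinvariantPart_apply (b : B) :
    coinvariantPart θ S' b = sw (ϱ b) fun x h => θ (S' h) * x := rfl

/-- Applying the coaction gives ∑ θ(S'(b₃)) b₀ ⊗ S'(b₂) b₁, and the second factor collapses to 1. -/
theorem coinvariantPart_mem (hθ : IsTotalIntegral θ) (hS : IsTwistedAntipode R H S') (b : B) :
    coinvariantPart θ S' b ∈ coinvariants R H B := by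
  change ϱ _ = _ ⊗ₜ[R] (1 : H)
  rw [coinvariantPart_apply, map_sw, sw_tmul_right]
  have e₁ : ∀ x h, ϱ (θ (S' h) * x) = sw (ϱ x) fun x₀ x₁ => sw (Δ h) fun h₁ h₂ =>
      (θ (S' h₂) * x₀) ⊗ₜ (S' h₁ * x₁) := by
    intro x h
    rw [map_mul, coaction_total_twistedAntipode hθ hS]
    conv_lhs => rw [← sw_tmul_self (ϱ x)]
    simp only [sw_mul, mul_sw, Algebra.TensorProduct.tmul_mul_tmul]
  simp only [e₁]
  rw [sw_coaction_assoc b (fun x₀ x₁ h => sw (Δ h) fun h₁ h₂ =>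
      (θ (S' h₂) * x₀) ⊗ₜ[R] (S' h₁ * x₁))]
  refine congrArg _ (funext₂ fun x h => ?_)
  rw [← sw_assoc h (fun x₁ h₁ h₂ => (θ (S' h₂) * x) ⊗ₜ[R] (S' h₁ * x₁))]
  exact hS.collapses_right.left h (fun z h₂ => (θ (S' h₂) * x) ⊗ₜ[R] z)

theorem sw_coaction_mul (hθ : IsTotalIntegral θ) (hinv : IsConvInverse θ θinv)
    (hS : IsTwistedAntipode R H S') (a : coinvariants R H B) (h : H) {φ : B → H → M}
    (h₁ : ∀ y, IsLinearMap R fun x => φ x y := by fun_prop)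
    (h₂ : ∀ x, IsLinearMap R fun y => φ x y := by fun_prop) :
    sw (ϱ (θinv (S' h) * a)) φ = sw (Δ h) fun x y => φ (θinv (S' x) * a) y := by
  refine sw_of_eq ?_ h₁ h₂
  rw [map_mul, coaction_coinvariant, coaction_inverse_twistedAntipode hθ hinv hS, sw_mul]
  simp only [Algebra.TensorProduct.tmul_mul_tmul, mul_one]

theorem coinvariantPart_mul (hθ : IsTotalIntegral θ) (hinv : IsConvInverse θ θinv)
    (hS : IsTwistedAntipode R H S') (a : coinvariants R H B) (h : H) :
    coinvariantPart θ S' (θinv (S' h) * a) = ε h • (a : B) := by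
  rw [coinvariantPart_apply, sw_coaction_mul hθ hinv hS]
  have := (hinv.collapses_right.comp_twistedAntipode hS).apply h (fun x => x * (a : B))
  simpa only [mul_assoc, one_mul] using this

/-- The map `h ⊗ a ↦ θ⁻¹(S' h) a`. -/
def normalBasisMap (θinv : H →ₗ[R] B) (S' : H →ₗ[R] H) : H ⊗[R] coinvariants R H B →ₗ[R] B :=
  TensorProduct.lift (LinearMap.mk₂ R (fun h (a : coinvariants R H B) => θinv (S' h) * a)
      (by simp [add_mul]) (by simp) (by simp [mul_add]) (by simp))

@[simp] theorem normalBasisMap_tmul (h : H) (a : coinvariants R H B) :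
    normalBasisMap θinv S' (h ⊗ₜ a) = θinv (S' h) * a := rfl

theorem normalBasisMap_bijective (hθ : IsTotalIntegral θ) (hinv : IsConvInverse θ θinv)
    (hS : IsTwistedAntipode R H S') :
    Function.Bijective (normalBasisMap θinv S' : H ⊗[R] coinvariants R H B →ₗ[R] B) := by
  let κ : B →ₗ[R] coinvariants R H B := (coinvariantPart θ S').codRestrict
    (Subalgebra.toSubmodule (coinvariants R H B)) (coinvariantPart_mem hθ hS)
  have hκ : ∀ h (a : coinvariants R H B), κ (θinv (S' h) * a) = ε h • a := fun h a =>
    Subtype.ext (coinvariantPart_mul hθ hinv hS a h)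
  -- The inverse is b ↦ ∑ b₁ ⊗ κ(b₀), where κ kills η(h) a up to the scalar: κ(η(h) a) = ε(h) a.
  let inv : B →ₗ[R] H ⊗[R] coinvariants R H B :=
    (show IsLinearMap R fun b : B => sw (ϱ b) fun x h => h ⊗ₜ[R] κ x by fun_prop).mk'
  have hl : inv ∘ₗ normalBasisMap θinv S' = LinearMap.id := by
    ext h a
    change (sw (ϱ (θinv (S' h) * a)) fun x h => h ⊗ₜ[R] κ x) = h ⊗ₜ a
    rw [sw_coaction_mul hθ hinv hS]
    simp only [hκ, TensorProduct.tmul_smul]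
    exact sw_counit_left h fun h => h ⊗ₜ[R] a
  have hr : normalBasisMap θinv S' ∘ₗ inv = LinearMap.id := by
    ext b
    change normalBasisMap θinv S' (sw (ϱ b) fun x h => h ⊗ₜ[R] κ x) = b
    rw [map_sw]
    change (sw (ϱ b) fun x h => θinv (S' h) * sw (ϱ x) fun x y => θ (S' y) * x) = b
    simp only [mul_sw]
    rw [sw_coaction_assoc b fun x₀ x₁ h => θinv (S' h) * (θ (S' x₁) * x₀)]
    have := (hinv.collapses_left.comp_twistedAntipode hS).coaction b (fun x z => z * x)
    simpa only [mul_assoc, one_mul] using this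
  exact ⟨Function.LeftInverse.injective (g := inv) (LinearMap.congr_fun hl),
    Function.RightInverse.surjective (g := inv) (LinearMap.congr_fun hr)⟩

end Cleft

/-! ### Purity in R^X and injectivity of the evaluation U ⊗ N → Hom(H, N). -/

section Purity

variable {R : Type u} [CommRing R]

/-- Over a Noetherian ring, `N ⊗ R^X → N^X` is injective. -/
theorem piScalarRightHom_injective [IsNoetherianRing R] (N : Type*) [AddCommGroup N] [Module R N]
    (X : Type*) : Function.Injective (TensorProduct.piScalarRightHom R R N X) := by
  rw [injective_iff_map_eq_zero]
  intro t ht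
  obtain ⟨k, n, f, rfl⟩ := TensorProduct.exists_sum_tmul_eq t
  let π : (Fin k → R) →ₗ[R] N := Fintype.linearCombination R n
  have hmem : ∀ x, (fun i => f i x) ∈ LinearMap.ker π := by
    intro x
    have := congrFun ht x
    simpa [π, Fintype.linearCombination_apply] using this
  -- Finitely many relations g l among the n i serve every point x at once, so the pointwise
  -- coefficients c x assemble into functions on X. This is where R has to be Noetherian.
  obtain ⟨m, g, hg⟩ := Submodule.fg_iff_exists_fin_generating_family.1
    (IsNoetherian.noetherian (LinearMap.ker π))
  have hg0 : ∀ l, π (g l) = 0 := fun l => by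
    have : g l ∈ LinearMap.ker π := hg ▸ Submodule.subset_span ⟨l, rfl⟩
    exact this
  have hc : ∀ x, ∃ c : Fin m → R, ∑ l, c l • g l = fun i => f i x := by
    intro x
    have := hmem x
    rw [← hg] at this
    exact (Submodule.mem_span_range_iff_exists_fun R).1 this
  choose c hc using hc
  have hf : ∀ i, f i = ∑ l, g l i • fun x => c x l := by
    intro i
    ext x
    rw [← congrFun (hc x) i]
    simp [mul_comm]
  calc ∑ i, n i ⊗ₜ[R] f i = ∑ i, ∑ l, (g l i • n i) ⊗ₜ[R] (fun x => c x l) := by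
        refine Finset.sum_congr rfl fun i _ => ?_
        conv_lhs => rw [hf i, TensorProduct.tmul_sum]
        simp only [TensorProduct.smul_tmul]
    _ = ∑ l, π (g l) ⊗ₜ[R] (fun x => c x l) := by
        rw [Finset.sum_comm]
        simp only [π, Fintype.linearCombination_apply, TensorProduct.sum_tmul]
    _ = 0 := by simp [hg0]

theorem isPureFor_congr {M : Type*} [AddCommGroup M] [Module R M] {K : Submodule R M}
    {N N' : Type*} [AddCommGroup N] [Module R N] [AddCommGroup N'] [Module R N'] (e : N ≃ₗ[R] N')
    (h : IsPureFor N K) : IsPureFor N' K := by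
  have : (K.subtype.rTensor N') = (e.lTensor M).toLinearMap ∘ₗ K.subtype.rTensor N ∘ₗ
      (e.symm.lTensor K).toLinearMap := by
    ext; simp
  unfold IsPureFor
  rw [this]
  exact (e.lTensor M).injective.comp (h.comp (e.symm.lTensor K).injective)

/-- Purity tests only modules in the universe of R. A kernel element comes from a finitely generated
N' ⊆ N, which is small. Its vanishing over N passes to N' by comparison inside the function modules
N'^X ⊆ N^X. -/
theorem IsPure.isPureFor [IsNoetherianRing R] {X : Type*} {K : Submodule R (X → R)}
    (hK : IsPure K) (N : Type*) [AddCommGroup N] [Module R N] : IsPureFor N K := by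
  unfold IsPureFor
  rw [injective_iff_map_eq_zero]
  intro t ht
  obtain ⟨N', hN', hsub⟩ := TensorProduct.exists_finite_submodule_right_of_setFinite {t}
    (Set.finite_singleton t)
  obtain ⟨t', rfl⟩ := hsub (Set.mem_singleton t)
  have : Small.{u} N' := Module.Finite.small R N'
  have hpure : IsPureFor N' K := isPureFor_congr (Shrink.linearEquiv R N') (hK (Shrink.{u} N'))
  have key : (N'.subtype.compLeft X) ∘ₗ TensorProduct.piScalarRightHom R R N' X ∘ₗ
      (TensorProduct.comm R (X → R) N').toLinearMap ∘ₗ K.subtype.rTensor N' =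
      TensorProduct.piScalarRightHom R R N X ∘ₗ (TensorProduct.comm R (X → R) N).toLinearMap ∘ₗ
        K.subtype.rTensor N ∘ₗ N'.subtype.lTensor K := by
    ext f n x
    simp
  have h0 := LinearMap.congr_fun key t'
  simp only [LinearMap.comp_apply, ht, map_zero] at h0
  have hinj : Function.Injective (N'.subtype.compLeft X) := fun a b hab => by
    ext x
    exact congrFun hab x
  have h1 := (piScalarRightHom_injective N' X) (hinj (h0.trans (map_zero _).symm) |>.trans
    (map_zero _).symm)
  have h2 : t' = 0 := hpure <| (TensorProduct.comm R (X → R) N').injective <|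
    h1.trans (by simp)
  rw [h2, map_zero]

variable {H : Type v} [AddCommGroup H] [Module R H]

theorem ltoFun_injective : Function.Injective (LinearMap.ltoFun R H R R) :=
  DFunLike.coe_injective

theorem isPureFor_asFunctions_iff (U : Submodule R (Module.Dual R H)) (N : Type*) [AddCommGroup N]
    [Module R N] : IsPureFor N (asFunctions U) ↔
      Function.Injective ((LinearMap.ltoFun R H R R ∘ₗ U.subtype).rTensor N) := by
  let e : U ≃ₗ[R] asFunctions U :=
    Submodule.equivMapOfInjective (LinearMap.ltoFun R H R R) ltoFun_injective U
  have : (LinearMap.ltoFun R H R R ∘ₗ U.subtype).rTensor N =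
      (asFunctions U).subtype.rTensor N ∘ₗ (e.rTensor N).toLinearMap := by
    refine TensorProduct.ext' fun f n => ?_
    rfl
  rw [this, LinearMap.coe_comp, LinearEquiv.coe_coe, EquivLike.injective_comp]
  rfl

/-- The evaluation map `U ⊗ N → Hom(H, N)`, `f ⊗ n ↦ [k ↦ f(k) n]`. -/
def dualEval (U : Submodule R (Module.Dual R H)) (N : Type*) [AddCommGroup N] [Module R N] :
    U ⊗[R] N →ₗ[R] H →ₗ[R] N :=
  TensorProduct.lift (LinearMap.smulRightₗ (R := R) (M := N) (M₂ := H) ∘ₗ U.subtype)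

@[simp] theorem dualEval_tmul (U : Submodule R (Module.Dual R H)) {N : Type*} [AddCommGroup N]
    [Module R N] (f : U) (n : N) (k : H) : dualEval U N (f ⊗ₜ n) k = f.1 k • n := rfl

/-- The evaluation factors as U ⊗ N → R^H ⊗ N → N^H: the first map is injective by purity, the
second by `piScalarRightHom_injective`. -/
theorem dualEval_injective [IsNoetherianRing R] {U : Submodule R (Module.Dual R H)} {N : Type*}
    [AddCommGroup N] [Module R N] (h : IsPureFor N (asFunctions U)) :
    Function.Injective (dualEval U N) := by
  rw [isPureFor_asFunctions_iff] at h
  have key : LinearMap.ltoFun R H N R ∘ₗ dualEval U N =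
      TensorProduct.piScalarRightHom R R N H ∘ₗ (TensorProduct.comm R (H → R) N).toLinearMap ∘ₗ
        (LinearMap.ltoFun R H R R ∘ₗ U.subtype).rTensor N := by
    ext f n x
    simp
  refine Function.Injective.of_comp (f := LinearMap.ltoFun R H N R) ?_
  rw [← LinearMap.coe_comp, key]
  exact (piScalarRightHom_injective N H).comp
    ((TensorProduct.comm R (H → R) N).injective.comp h)

end Purity

/-! ### The finite dual: criteria for purity and for density. -/

section FiniteDual

variable {R : Type u} {H : Type v} [CommRing R] [IsNoetherianRing R] [Ring H]

theorem IsSubbialgebra.isPureFor [Bialgebra R H] {U : ModuleSubalgebra R H}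
    (hH : IsAlphaAlgebra R H) (hU : IsSubbialgebra R H U) (N : Type*) [AddCommGroup N]
    [Module R N] : IsPureFor N (asFunctions U.toSubmodule) := by
  refine IsPure.isPureFor (fun N _ _ => ?_) N
  rw [isPureFor_asFunctions_iff]
  have h₁ := (isPureFor_asFunctions_iff (finiteDual R H) N).1 (hH N)
  have h₂ : Function.Injective _ := hU.pure N
  let e := Submodule.submoduleOfEquivOfLe hU.le
  have : LinearMap.ltoFun R H R R ∘ₗ U.toSubmodule.subtype =
      (LinearMap.ltoFun R H R R ∘ₗ (finiteDual R H).subtype) ∘ₗ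
        (U.toSubmodule.submoduleOf (finiteDual R H)).subtype ∘ₗ e.symm.toLinearMap := rfl
  rw [this, LinearMap.rTensor_comp, LinearMap.rTensor_comp N (Submodule.subtype _)]
  exact h₁.comp (h₂.comp (e.symm.rTensor N).injective)

/-- Over a self-injective Noetherian ring, a submodule of `H^*` that separates the points of `H`
is dense. -/
theorem exists_eqOn_of_separating (hR : Module.Injective R R) [Module R H]
    (W : Submodule R (Module.Dual R H)) (hW : ∀ h : H, (∀ f ∈ W, f h = 0) → h = 0)
    (f : Module.Dual R H) (F : Finset H) : ∃ g ∈ W, ∀ h ∈ F, g h = f h := by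
  let K : Submodule R H := Submodule.span R F
  have : Module.Finite R K := Module.Finite.span_finset R F
  let res : Module.Dual R H →ₗ[R] Module.Dual R K := LinearMap.lcomp R R K.subtype
  obtain ⟨n, w, hw⟩ := Submodule.fg_iff_exists_fin_generating_family.1
    (IsNoetherian.noetherian (W.map res))
  -- Finitely many restrictions w i generate all those of W, so they still separate the points of K
  -- and embed K in Rⁿ.
  let ev : K →ₗ[R] Fin n → R := LinearMap.pi w
  have hker : ∀ k, ev k = 0 → k = 0 := by
    intro k hk
    refine Subtype.ext (hW k fun f hf => ?_)
    have hmem : res f ∈ Submodule.span R (Set.range w) := hw ▸ Submodule.mem_map_of_mem hf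
    obtain ⟨c, hc⟩ := (Submodule.mem_span_range_iff_exists_fun R).1 hmem
    have : res f k = 0 := by
      rw [← hc]
      simpa using Finset.sum_eq_zero fun i _ => by
        have : w i k = 0 := congrFun hk i
        rw [this, mul_zero]
    exact this
  let e := LinearEquiv.ofInjective ev ((injective_iff_map_eq_zero ev).2 hker)
  -- Self-injectivity extends f from the image of K to φ on Rⁿ; the values of φ on the standard
  -- basis are the coefficients of f in terms of the w i.
  obtain ⟨φ, hφ⟩ := hR.out (LinearMap.range ev).subtype Subtype.val_injective
    (f ∘ₗ K.subtype ∘ₗ e.symm.toLinearMap)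
  have hmem : ∑ i, φ (Pi.single i 1) • w i ∈ W.map res := hw ▸
    Submodule.sum_mem _ fun i _ => Submodule.smul_mem _ _ (Submodule.subset_span ⟨i, rfl⟩)
  obtain ⟨g, hg, hgw⟩ := hmem
  refine ⟨g, hg, fun h hh => ?_⟩
  let k : K := ⟨h, Submodule.subset_span hh⟩
  have h₁ : g h = ∑ i, φ (Pi.single i 1) * w i k := by
    have := LinearMap.congr_fun hgw k
    simpa [res] using this
  have h₂ : φ (ev k) = f h := by
    have := hφ (e k)
    simpa [e, k] using this
  rw [h₁, ← h₂, LinearMap.pi_apply_eq_sum_univ φ]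
  refine Finset.sum_congr rfl fun i _ => ?_
  rw [smul_eq_mul, mul_comm]
  congr 2
  ext j
  simp [Pi.single_apply, eq_comm]

theorem isDenseIn_univ_of_isQuasiFrobenius [Algebra R H] (hR : IsQuasiFrobenius R)
    (hH : IsResiduallyFinite R H) {U : Submodule R (Module.Dual R H)}
    (hU : IsDenseIn (U : Set (Module.Dual R H)) (finiteDual R H)) :
    IsDenseIn (U : Set (Module.Dual R H)) Set.univ := by
  refine ⟨Set.subset_univ _, fun f _ F => ?_⟩
  obtain ⟨g, hg, hgf⟩ := exists_eqOn_of_separating hR.2 (finiteDual R H) hH f F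
  obtain ⟨s, hs, hsg⟩ := hU.2 g hg F
  exact ⟨s, hs, fun m hm => (hsg m hm).trans (hgf m hm)⟩

end FiniteDual

/-! ### The evaluation maps into Hom(H, B) and Hom(H, H ⊗ A), and their injectivity. -/

section Evaluation

variable {R H B : Type*} [CommRing R] [Ring H] [Bialgebra R H] [Ring B] [Algebra R B]
  {U : Submodule R (Module.Dual R H)}

local notation "Δ" => Coalgebra.comul (R := R)
local notation "ε" => Coalgebra.counit (R := R)

theorem leftHit_eq_sw (f : Module.Dual R H) (k : H) :
    leftHit R H f k = sw (Δ k) fun x y => f y • x :=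
  (sw_apply ((TensorProduct.rid R H).toLinearMap ∘ₗ f.lTensor H) (Δ k)).symm

theorem rightHit_eq_sw (f : Module.Dual R H) (k : H) :
    rightHit R H f k = sw (Δ k) fun x y => f x • y :=
  (sw_apply ((TensorProduct.lid R H).toLinearMap ∘ₗ f.rTensor H) (Δ k)).symm

theorem conv_eq_sw (f g : Module.Dual R H) (k : H) :
    conv R H f g k = sw (Δ k) fun x y => f x * g y :=
  (sw_apply (LinearMap.mul' R R ∘ₗ TensorProduct.map f g) (Δ k)).symm

@[simp] theorem leftHit_counit (k : H) : leftHit R H ε k = k := by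
  rw [leftHit_eq_sw]
  exact sw_counit_right k fun x => x

/-- The map `b ⊗ f ↦ [k ↦ b η(f ⇀ k)]`. -/
def smashEval (η : H →ₗ[R] B) (U : Submodule R (Module.Dual R H)) : B ⊗[R] U →ₗ[R] H →ₗ[R] B :=
  TensorProduct.lift (LinearMap.mk₂ R
    (fun b (f : U) => LinearMap.mulLeft R b ∘ₗ η ∘ₗ leftHit R H f)
    (fun _ _ _ => by ext; simp [add_mul]) (fun _ _ _ => by ext; simp)
    (fun _ _ _ => by ext; simp [mul_add]) (fun _ _ _ => by ext; simp))

@[simp] theorem smashEval_tmul (η : H →ₗ[R] B) (b : B) (f : U) (k : H) :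
    smashEval η U (b ⊗ₜ f) k = b * η (leftHit R H f k) := rfl

/-- The map `a ⊗ x ↦ [k ↦ Λ(x)(k) ⊗ a]`. -/
def tensorEval {X : Type*} [AddCommMonoid X] [Module R X] (A : Type*) [AddCommGroup A] [Module R A]
    (Λ : X →ₗ[R] Module.End R H) : A ⊗[R] X →ₗ[R] H →ₗ[R] H ⊗[R] A :=
  TensorProduct.lift (LinearMap.mk₂ R
    (fun a x => (TensorProduct.mk R H A).flip a ∘ₗ Λ x)
    (fun _ _ _ => by ext; simp)
    (fun _ _ _ => by ext; simp)
    (fun _ _ _ => by ext; simp)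
    (fun _ _ _ => by ext; simp [TensorProduct.smul_tmul']))

@[simp] theorem tensorEval_tmul {X A : Type*} [AddCommMonoid X] [Module R X] [AddCommGroup A]
    [Module R A] (Λ : X →ₗ[R] Module.End R H) (a : A) (x : X) (k : H) :
    tensorEval A Λ (a ⊗ₜ x) k = Λ x k ⊗ₜ a := rfl

/-- Recovers `smashEval` from the plain evaluation; `sw_smashEval_mul` goes back when η is
invertible. -/
theorem sw_dualEval_mul (η : H →ₗ[R] B) (t : B ⊗[R] U) (k : H) :
    (sw (Δ k) fun x y => dualEval U B (TensorProduct.comm R B U t) y * η x) =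
      smashEval η U t k := by
  induction t with
  | zero => simp [sw]
  | add t t' h h' => simp only [map_add, LinearMap.add_apply, ← h, ← h', add_mul, sw,
      Finset.sum_add_distrib]
  | tmul b f =>
    simp only [dualEval_tmul, TensorProduct.comm_tmul, smashEval_tmul, leftHit_eq_sw, map_sw,
      mul_sw, map_smul, smul_mul_assoc, mul_smul_comm]

/-- On b ⊗ f the left side is ∑ f(k₃) b η(k₂) ζ(k₁), where η(k₂) ζ(k₁) cancels. -/
theorem sw_smashEval_mul {η ζ : H →ₗ[R] B} (h : Collapses R (fun x y => η y * ζ x) 1)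
    (t : B ⊗[R] U) (k : H) :
    (sw (Δ k) fun x y => smashEval η U t y * ζ x) =
      dualEval U B (TensorProduct.comm R B U t) k := by
  induction t with
  | zero => simp [sw]
  | add t t' h h' => simp only [map_add, LinearMap.add_apply, ← h, ← h', add_mul, sw,
      Finset.sum_add_distrib]
  | tmul b f =>
    simp only [dualEval_tmul, TensorProduct.comm_tmul, smashEval_tmul, leftHit_eq_sw, map_sw,
      mul_sw, sw_mul, map_smul, smul_mul_assoc, mul_smul_comm]
    rw [← sw_assoc k fun p q s => (f : Module.Dual R H) s • (b * η q * ζ p)]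
    have := h.left k fun z s => (f : Module.Dual R H) s • (b * z)
    simpa only [mul_assoc, mul_one] using this

theorem smashEval_injective {η ζ : H →ₗ[R] B} (h : Collapses R (fun x y => η y * ζ x) 1)
    (hU : Function.Injective (dualEval U B)) : Function.Injective (smashEval η U) := by
  rw [injective_iff_map_eq_zero]
  intro t ht
  refine (TensorProduct.comm R B U).injective (hU ?_) |>.trans rfl
  ext k
  rw [map_zero, map_zero, ← sw_smashEval_mul h, ht]
  simp [sw]

/-- The analogue of `sw_smashEval_mul` with S' as the inverse of the identity: ∑ f(k₃) h k₂ S'(k₁) =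
f(k) h. -/
theorem sw_rTensor_tensorEval {S' : H →ₗ[R] H} (hS : IsTwistedAntipode R H S') {A : Type*}
    [AddCommGroup A] [Module R A] (t : A ⊗[R] (H ⊗[R] U)) (k : H) :
    (sw (Δ k) fun x y => (LinearMap.mulRight R (S' x)).rTensor A (tensorEval A (lam R H U) t y)) =
      dualEval U (H ⊗[R] A) (((TensorProduct.comm R A (H ⊗[R] U)).trans
        (((TensorProduct.comm R H U).rTensor A).trans (TensorProduct.assoc R U H A))) t) k := by
  induction t with
  | zero => simp [sw]
  | add t t' h h' => simp only [map_add, LinearMap.add_apply, ← h, ← h', sw,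
      Finset.sum_add_distrib]
  | tmul a t =>
    induction t with
    | zero => simp [sw]
    | add t t' h h' => simp only [map_add, TensorProduct.tmul_add, LinearMap.add_apply, ← h, ← h',
        sw, Finset.sum_add_distrib]
    | tmul h f =>
      have e : (((TensorProduct.comm R A (H ⊗[R] U)).trans
        (((TensorProduct.comm R H U).rTensor A).trans (TensorProduct.assoc R U H A)))
          (a ⊗ₜ[R] (h ⊗ₜ[R] f))) = f ⊗ₜ (h ⊗ₜ a) := rfl
      simp only [e, dualEval_tmul, tensorEval_tmul, lam_tmul, leftHit_eq_sw, mul_sw, sw_tmul_right,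
        map_sw, LinearMap.rTensor_tmul, LinearMap.mulRight_apply, mul_smul_comm, map_smul,
        ← TensorProduct.smul_tmul']
      rw [← sw_assoc k fun p q s => (f : Module.Dual R H) s • (h * q * S' p) ⊗ₜ[R] a]
      have := hS.collapses_left.left k fun z s => (f : Module.Dual R H) s • (h * z) ⊗ₜ[R] a
      simpa only [mul_assoc, mul_one] using this

theorem tensorEval_lam_injective {S' : H →ₗ[R] H} (hS : IsTwistedAntipode R H S') {A : Type*}
    [AddCommGroup A] [Module R A] (hU : Function.Injective (dualEval U (H ⊗[R] A))) :
    Function.Injective (tensorEval A (lam R H U)) := by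
  rw [injective_iff_map_eq_zero]
  intro t ht
  refine LinearEquiv.injective ((TensorProduct.comm R A (H ⊗[R] U)).trans
      (((TensorProduct.comm R H U).rTensor A).trans (TensorProduct.assoc R U H A))) (hU ?_)
  ext k
  rw [map_zero, map_zero, ← sw_rTensor_tensorEval hS, ht]
  simp [sw]

end Evaluation

/-! ### The identities satisfied by φ̃ and ψ̃. -/

section Identities

variable {R H B M : Type*} [CommRing R] [Ring H] [Bialgebra R H] [Ring B] [Algebra R B]
  [AddCommGroup M] [Module R M] {θ θinv : H →ₗ[R] B} {S' : H →ₗ[R] H}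

local notation "Δ" => Coalgebra.comul (R := R)
local notation "ε" => Coalgebra.counit (R := R)

theorem phiTilde_eq_sw (h : H) (a : B) (x : H) :
    phiTilde θ θinv S' h a x = sw (Δ h) fun h₁ h₂ => sw (Δ x) fun x₁ x₂ =>
      θ (S' x₂) * a * θ h₁ * θinv (S' x₁ * h₂) :=
  phiTilde_apply θ θinv S' h a x (.arbitrary R x) (.arbitrary R h)

theorem psiTilde_eq_sw (h : H) (a : B) (x : H) :
    psiTilde θ θinv S' h a x = sw (Δ h) fun h₁ h₂ => sw (Δ x) fun l r => sw (Δ l) fun l₁ l₂ =>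
      sw (Δ r) fun r₁ r₂ => θinv (S' r₁) * a * θ (S' l₂ * h₁) * θinv (r₂ * S' l₁ * h₂) :=
  psiTilde_apply θ θinv S' h a x (.arbitrary R x) (.arbitrary R h)
    (fun _ => .arbitrary R _) (fun _ => .arbitrary R _)

/-- The new factor cancels the leading factor of φ̃: θ⁻¹(S'(y₃)) θ(S'(y₂)) collapses. -/
theorem sw_mul_phiTilde (hinv : IsConvInverse θ θinv) (hS : IsTwistedAntipode R H S')
    (h : H) (a : B) (y : H) :
    (sw (Δ y) fun y₁ y₂ => θinv (S' y₂) * phiTilde θ θinv S' h a y₁) =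
      sw (Δ h) fun h₁ h₂ => a * θ h₁ * θinv (S' y * h₂) := by
  simp only [phiTilde_eq_sw, mul_sw]
  have : ∀ h₁ h₂, (sw (Δ y) fun y₁ y₂ => sw (Δ y₁) fun x₁ x₂ =>
      θinv (S' y₂) * (θ (S' x₂) * a * θ h₁ * θinv (S' x₁ * h₂))) =
      a * θ h₁ * θinv (S' y * h₂) := by
    intro h₁ h₂
    rw [sw_assoc y fun x₁ x₂ y₂ => θinv (S' y₂) * (θ (S' x₂) * a * θ h₁ * θinv (S' x₁ * h₂))]
    have := (hinv.collapses_left.comp_twistedAntipode hS).right y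
      fun x z => z * (a * θ h₁ * θinv (S' x * h₂))
    simpa only [mul_assoc, one_mul] using this
  simp only [← this]
  rw [sw_comm]

/-- Taking y = h₃k in `sw_mul_phiTilde` produces S'(k) S'(h₃) h₂, in which S'(h₃) h₂ collapses. -/
theorem sw_sw_mul_phiTilde (hinv : IsConvInverse θ θinv) (hS : IsTwistedAntipode R H S')
    (h : H) (a : B) (k : H) :
    (sw (Δ h) fun p q => sw (Δ (q * k)) fun y₁ y₂ =>
      θinv (S' y₂) * phiTilde θ θinv S' p a y₁) = a * θ h * θinv (S' k) := by
  simp only [sw_mul_phiTilde hinv hS, hS.map_mul]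
  rw [sw_assoc h fun p₁ p₂ q => a * θ p₁ * θinv (S' k * S' q * p₂)]
  have := hS.collapses_right.right h fun x z => a * θ x * θinv (S' k * z)
  simpa only [mul_assoc, mul_one] using this

/-- Both sides split x into the six legs x₁, l₁, l₂, r₁, r₂, x₃ in this order. The new bracketing
pairs x₁ with l₁ and r₂ with x₃, the legs to be cancelled. -/
theorem sw_psi_reassoc (p q c : H) (a : B) (x : H) :
    (sw (Δ x) fun x₁ x' => sw (Δ x') fun x₂ x₃ => sw (Δ x₂) fun l r => sw (Δ l) fun l₁ l₂ =>
      sw (Δ r) fun r₁ r₂ => θinv (S' r₁) * a * θ (S' l₂ * p) * θinv (r₂ * S' l₁ * q) *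
        θ (x₃ * S' x₁ * c)) =
    sw (Δ x) fun w y => sw (Δ w) fun u l₂ => sw (Δ y) fun r₁ v =>
      sw (Δ u) fun x₁ l₁ => sw (Δ v) fun r₂ x₃ =>
        θinv (S' r₁) * a * θ (S' l₂ * p) * θinv (r₂ * S' l₁ * q) * θ (x₃ * S' x₁ * c) := by
  have e₁ : ∀ x₁ x', (sw (Δ x') fun x₂ x₃ => sw (Δ x₂) fun l r => sw (Δ l) fun l₁ l₂ =>
      sw (Δ r) fun r₁ r₂ => θinv (S' r₁) * a * θ (S' l₂ * p) * θinv (r₂ * S' l₁ * q) *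
        θ (x₃ * S' x₁ * c)) = sw (Δ x') fun l y => sw (Δ y) fun r x₃ => sw (Δ l) fun l₁ l₂ =>
      sw (Δ r) fun r₁ r₂ => θinv (S' r₁) * a * θ (S' l₂ * p) * θinv (r₂ * S' l₁ * q) *
        θ (x₃ * S' x₁ * c) := fun x₁ x' =>
    sw_assoc x' fun l r x₃ => sw (Δ l) fun l₁ l₂ =>
      sw (Δ r) fun r₁ r₂ => θinv (S' r₁) * a * θ (S' l₂ * p) * θinv (r₂ * S' l₁ * q) *
        θ (x₃ * S' x₁ * c)
  simp only [e₁]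
  rw [← sw_assoc x fun x₁ l y => sw (Δ y) fun r x₃ => sw (Δ l) fun l₁ l₂ =>
      sw (Δ r) fun r₁ r₂ => θinv (S' r₁) * a * θ (S' l₂ * p) * θinv (r₂ * S' l₁ * q) *
        θ (x₃ * S' x₁ * c)]
  refine congrArg _ (funext₂ fun w y => ?_)
  have e₂ : ∀ x₁ l, (sw (Δ y) fun r x₃ => sw (Δ l) fun l₁ l₂ =>
      sw (Δ r) fun r₁ r₂ => θinv (S' r₁) * a * θ (S' l₂ * p) * θinv (r₂ * S' l₁ * q) *
        θ (x₃ * S' x₁ * c)) = sw (Δ l) fun l₁ l₂ => sw (Δ y) fun r₁ v =>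
      sw (Δ v) fun r₂ x₃ => θinv (S' r₁) * a * θ (S' l₂ * p) * θinv (r₂ * S' l₁ * q) *
        θ (x₃ * S' x₁ * c) := by
    intro x₁ l
    rw [sw_comm]
    refine congrArg _ (funext₂ fun l₁ l₂ => ?_)
    exact sw_assoc y fun r₁ r₂ x₃ => θinv (S' r₁) * a * θ (S' l₂ * p) * θinv (r₂ * S' l₁ * q) *
        θ (x₃ * S' x₁ * c)
  simp only [e₂]
  rw [← sw_assoc w fun x₁ l₁ l₂ => sw (Δ y) fun r₁ v =>
      sw (Δ v) fun r₂ x₃ => θinv (S' r₁) * a * θ (S' l₂ * p) * θinv (r₂ * S' l₁ * q) *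
        θ (x₃ * S' x₁ * c)]
  refine congrArg _ (funext₂ fun u l₂ => ?_)
  rw [sw_comm]

/-- After regrouping, the last two factors form the convolution θ⁻¹ ⋆ θ at the single element v
S'(u) h', so they collapse to ε(v) ε(u) ε(h'). -/
theorem sw_psiTilde_mul (hinv : IsConvInverse θ θinv) (hS : IsTwistedAntipode R H S')
    (h : H) (a : B) (x : H) :
    (sw (Δ h) fun h₁ h₂ => sw (Δ x) fun x₁ x' => sw (Δ x') fun x₂ x₃ =>
      psiTilde θ θinv S' h₁ a x₂ * θ (x₃ * S' x₁ * h₂)) =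
      sw (Δ x) fun x₁ x₂ => θinv (S' x₂) * a * θ (S' x₁ * h) := by
  have e₁ : ∀ h₁ h₂, (sw (Δ x) fun x₁ x' => sw (Δ x') fun x₂ x₃ =>
      psiTilde θ θinv S' h₁ a x₂ * θ (x₃ * S' x₁ * h₂)) = sw (Δ h₁) fun p q =>
      sw (Δ x) fun w y => sw (Δ w) fun u l₂ => sw (Δ y) fun r₁ v =>
      sw (Δ u) fun x₁ l₁ => sw (Δ v) fun r₂ x₃ =>
        θinv (S' r₁) * a * θ (S' l₂ * p) * θinv (r₂ * S' l₁ * q) * θ (x₃ * S' x₁ * h₂) := by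
    intro h₁ h₂
    simp only [psiTilde_eq_sw, sw_mul, ← sw_psi_reassoc]
    rw [sw_comm (Δ h₁)]
    refine congrArg _ (funext₂ fun x₁ x' => ?_)
    rw [sw_comm]
  simp only [e₁]
  rw [sw_assoc h fun p q h₂ => sw (Δ x) fun w y => sw (Δ w) fun u l₂ => sw (Δ y) fun r₁ v =>
      sw (Δ u) fun x₁ l₁ => sw (Δ v) fun r₂ x₃ =>
        θinv (S' r₁) * a * θ (S' l₂ * p) * θinv (r₂ * S' l₁ * q) * θ (x₃ * S' x₁ * h₂)]
  have e₂ : ∀ (b : B) (u v h' : H), (sw (Δ h') fun q h₂ => sw (Δ u) fun x₁ l₁ =>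
      sw (Δ v) fun r₂ x₃ => b * θinv (r₂ * S' l₁ * q) * θ (x₃ * S' x₁ * h₂)) =
        ε v • ε u • ε h' • b := by
    intro b u v h'
    have := hinv.collapses_left.apply (v * S' u * h') fun z => b * z
    simp only [Bialgebra.counit_mul, hS.counit, mul_one] at this
    rw [mul_smul, mul_smul] at this
    rw [← this, sw_comul_mul, sw_comul_mul, sw_comm_three]
    refine congrArg _ (funext₂ fun r₂ x₃ => ?_)
    rw [hS.sw_comul u]
    simp only [mul_assoc]
  have e₃ : ∀ p h', (sw (Δ h') fun q h₂ => sw (Δ x) fun w y => sw (Δ w) fun u l₂ =>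
      sw (Δ y) fun r₁ v => sw (Δ u) fun x₁ l₁ => sw (Δ v) fun r₂ x₃ =>
        θinv (S' r₁) * a * θ (S' l₂ * p) * θinv (r₂ * S' l₁ * q) * θ (x₃ * S' x₁ * h₂)) =
      ε h' • sw (Δ x) fun w y => θinv (S' y) * a * θ (S' w * p) := by
    intro p h'
    rw [sw_comm, smul_sw]
    refine congrArg _ (funext₂ fun w y => ?_)
    rw [sw_comm, ← sw_counit_left (R := R) w fun w => ε h' • (θinv (S' y) * a * θ (S' w * p))]
    refine congrArg _ (funext₂ fun u l₂ => ?_)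
    rw [sw_comm, ← sw_counit_right (R := R) y fun y => ε u • ε h' • (θinv (S' y) * a * θ (S' l₂ * p))]
    refine congrArg _ (funext₂ fun r₁ v => ?_)
    exact e₂ _ u v h'
  simp only [e₃]
  exact sw_counit_right h fun p => sw (Δ x) fun w y => θinv (S' y) * a * θ (S' w * p)

/-- The hypothesis is applied with x = h₂k and h₁ in place of h. On both sides the first leg of x
contributes a factor of the form S'(h″) h′ with adjacent legs of h, which cancels. Only the
linearity of ψ̃ matters here, hence the abstract P. -/
theorem sw_sw_mul_of_sw_mul (hS : IsTwistedAntipode R H S') (a : B) {P : H → H → B}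
    (hP₁ : ∀ x, IsLinearMap R fun p => P p x) (hP₂ : ∀ p, IsLinearMap R fun x => P p x)
    (hP : ∀ h x, (sw (Δ h) fun h₁ h₂ => sw (Δ x) fun x₁ x' => sw (Δ x') fun x₂ x₃ =>
      P h₁ x₂ * θ (x₃ * S' x₁ * h₂)) =
      sw (Δ x) fun x₁ x₂ => θinv (S' x₂) * a * θ (S' x₁ * h)) (h k : H) :
    (sw (Δ h) fun p q => sw (Δ k) fun k₁ k₂ => sw (Δ (q * k₂)) fun y₁ y₂ =>
      P p y₁ * θ (y₂ * S' k₁)) =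
      sw (Δ k) fun k₁ k₂ => θinv (S' (h * k₂)) * a * θ (S' k₁) := by
  have e₁ : (sw (Δ h) fun h₁ h₂ => sw (Δ (h₂ * k)) fun x₁ x₂ =>
      θinv (S' x₂) * a * θ (S' x₁ * h₁)) =
      sw (Δ k) fun k₁ k₂ => θinv (S' (h * k₂)) * a * θ (S' k₁) := by
    have : ∀ h₁ h₂, (sw (Δ (h₂ * k)) fun x₁ x₂ => θinv (S' x₂) * a * θ (S' x₁ * h₁)) =
        sw (Δ h₂) fun p q => sw (Δ k) fun k₁ k₂ =>
          θinv (S' (q * k₂)) * a * θ (S' k₁ * (S' p * h₁)) := by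
      intro h₁ h₂
      rw [sw_comul_mul]
      simp only [hS.map_mul, mul_assoc]
    simp only [this]
    rw [← sw_assoc h fun h₁ p q => sw (Δ k) fun k₁ k₂ =>
          θinv (S' (q * k₂)) * a * θ (S' k₁ * (S' p * h₁))]
    rw [hS.collapses_right.left h fun z q => sw (Δ k) fun k₁ k₂ =>
          θinv (S' (q * k₂)) * a * θ (S' k₁ * z)]
    simp only [mul_one]
  rw [← e₁]
  simp only [← hP]
  have e₂ : ∀ h₁ h₂, (sw (Δ h₁) fun p q => sw (Δ (h₂ * k)) fun x₁ x' => sw (Δ x') fun x₂ x₃ =>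
      P p x₂ * θ (x₃ * S' x₁ * q)) =
      sw (Δ h₁) fun p q => sw (Δ h₂) fun r s => sw (Δ k) fun k₁ k₂ =>
        sw (Δ (s * k₂)) fun x₂ x₃ => P p x₂ * θ (x₃ * S' k₁ * (S' r * q)) := by
    intro h₁ h₂
    refine congrArg _ (funext₂ fun p q => ?_)
    rw [sw_comul_mul]
    simp only [hS.map_mul, mul_assoc]
  simp only [e₂]
  rw [sw_assoc h fun p q h₂ => sw (Δ h₂) fun r s => sw (Δ k) fun k₁ k₂ =>
        sw (Δ (s * k₂)) fun x₂ x₃ => P p x₂ * θ (x₃ * S' k₁ * (S' r * q))]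
  refine congrArg _ (funext₂ fun p h' => ?_)
  rw [← sw_assoc h' fun q r s => sw (Δ k) fun k₁ k₂ =>
        sw (Δ (s * k₂)) fun x₂ x₃ => P p x₂ * θ (x₃ * S' k₁ * (S' r * q))]
  rw [hS.collapses_right.left h' fun z s => sw (Δ k) fun k₁ k₂ =>
        sw (Δ (s * k₂)) fun x₂ x₃ => P p x₂ * θ (x₃ * S' k₁ * z)]
  simp only [mul_one]

theorem sw_sw_psiTilde_mul (hinv : IsConvInverse θ θinv) (hS : IsTwistedAntipode R H S')
    (h : H) (a : B) (k : H) :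
    (sw (Δ h) fun p q => sw (Δ k) fun k₁ k₂ => sw (Δ (q * k₂)) fun y₁ y₂ =>
      psiTilde θ θinv S' p a y₁ * θ (y₂ * S' k₁)) =
      sw (Δ k) fun k₁ k₂ => θinv (S' (h * k₂)) * a * θ (S' k₁) :=
  sw_sw_mul_of_sw_mul hS a
    (fun x => by
      simp only [psiTilde_eq_sw]
      fun_prop)
    (fun p => by fun_prop) (fun h x => sw_psiTilde_mul hinv hS h a x) h k

end Identities

/-! ### Equality of the two images in Hom(H, B). -/

section Range

variable {R H B : Type*} [CommRing R] [Ring H] [Bialgebra R H] [Ring B] [Algebra R B]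
  [RightComoduleAlgebra R H B] {θ θinv : H →ₗ[R] B} {S' : H →ₗ[R] H}
  {U : ModuleSubalgebra R H} {V : Submodule R (Module.Dual R H)}

local notation "Δ" => Coalgebra.comul (R := R)
local notation "ε" => Coalgebra.counit (R := R)
local notation "𝒜" => coinvariants R H B

theorem lam_rTensor_mulLeft (U : Submodule R (Module.Dual R H)) (q : H) (u : H ⊗[R] U) (k : H) :
    lam R H U ((LinearMap.mulLeft R q).rTensor U u) k = q * lam R H U u k := by
  induction u with
  | zero => simp
  | add u u' h h' => simp only [map_add, LinearMap.add_apply, h, h', mul_add]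
  | tmul h g => simp [mul_assoc]

/-- Since (hk) ↼ g = ∑ h₂ (k ↼ (g h₁)), the RL-condition is applied to the functionals g h₁, which
stay in V. -/
theorem RLCondition.exists_lam (hRL : RLCondition R H V U.toSubmodule)
    (hV : IsRightSubmodule R H V) {g : Module.Dual R H} (hg : g ∈ V) (h : H) :
    ∃ u : H ⊗[R] U.toSubmodule, ∀ k, rightHit R H g (h * k) = lam R H U.toSubmodule u k := by
  have : ∀ p, ∃ u, lam R H U.toSubmodule u = rightHit R H (regAct R H g p) := fun p =>
    hRL (Submodule.mem_map_of_mem (hV g hg p))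
  choose u hu using this
  refine ⟨sw (Δ h) fun p q => (LinearMap.mulLeft R q).rTensor _ (u p), fun k => ?_⟩
  have : ∀ t : H ⊗[R] U.toSubmodule, lam R H U.toSubmodule t k =
    (LinearMap.applyₗ k ∘ₗ lam R H U.toSubmodule) t := fun _ => rfl
  rw [this, map_sw]
  simp only [← this, lam_rTensor_mulLeft, hu, rightHit_eq_sw, regAct_apply, mul_sw, mul_smul_comm]
  rw [sw_comul_mul]

theorem leftHit_leftHit (g f : Module.Dual R H) (k : H) :
    leftHit R H g (leftHit R H f k) = leftHit R H (conv R H g f) k := by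
  simp only [leftHit_eq_sw f, map_sw, map_smul]
  simp only [leftHit_eq_sw, conv_eq_sw, smul_sw, sw_smul]
  rw [sw_assoc k fun p q r => f r • g q • p]
  simp only [smul_smul, mul_comm]

theorem lam_leftHit (u : H ⊗[R] U.toSubmodule) (f : U.toSubmodule) :
    ∃ u' : H ⊗[R] U.toSubmodule, ∀ k,
      lam R H U.toSubmodule u (leftHit R H f k) = lam R H U.toSubmodule u' k := by
  induction u with
  | zero => exact ⟨0, by simp⟩
  | add u u' h h' =>
    obtain ⟨v, hv⟩ := h
    obtain ⟨v', hv'⟩ := h'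
    exact ⟨v + v', fun k => by simp only [map_add, LinearMap.add_apply, hv, hv']⟩
  | tmul h g =>
    refine ⟨h ⊗ₜ ⟨conv R H g f, U.conv_mem' g.2 f.2⟩, fun k => ?_⟩
    simp only [lam_tmul, leftHit_leftHit]

theorem smashEval_leftHit (η : H →ₗ[R] B) (s : B ⊗[R] U.toSubmodule) (f : U.toSubmodule) :
    ∃ s' : B ⊗[R] U.toSubmodule, ∀ k,
      smashEval η U.toSubmodule s (leftHit R H f k) = smashEval η U.toSubmodule s' k := by
  induction s with
  | zero => exact ⟨0, by simp⟩
  | add u u' h h' =>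
    obtain ⟨v, hv⟩ := h
    obtain ⟨v', hv'⟩ := h'
    exact ⟨v + v', fun k => by simp only [map_add, LinearMap.add_apply, hv, hv']⟩
  | tmul b g =>
    refine ⟨b ⊗ₜ ⟨conv R H g f, U.conv_mem' g.2 f.2⟩, fun k => ?_⟩
    simp only [smashEval_tmul, leftHit_leftHit]

theorem tensorEval_leftHit {A : Type*} [AddCommGroup A] [Module R A]
    (s : A ⊗[R] (H ⊗[R] U.toSubmodule)) (f : U.toSubmodule) :
    ∃ s' : A ⊗[R] (H ⊗[R] U.toSubmodule), ∀ k,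
      tensorEval A (lam R H U.toSubmodule) s (leftHit R H f k) =
        tensorEval A (lam R H U.toSubmodule) s' k := by
  induction s with
  | zero => exact ⟨0, by simp⟩
  | add u u' h h' =>
    obtain ⟨v, hv⟩ := h
    obtain ⟨v', hv'⟩ := h'
    exact ⟨v + v', fun k => by simp only [map_add, LinearMap.add_apply, hv, hv']⟩
  | tmul a u =>
    obtain ⟨u', hu'⟩ := lam_leftHit u f
    exact ⟨a ⊗ₜ u', fun k => by simp only [tensorEval_tmul, hu']⟩

/-- For t = a ⊗ g and y = hk the right side is η(y ↼ g) a, which `RLCondition.exists_lam` rewrites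
through λ. -/
theorem exists_tensorEval_evalMap (hRL : RLCondition R H V U.toSubmodule)
    (hV : IsRightSubmodule R H V) (t : 𝒜 ⊗[R] V) (h : H) :
    ∃ s : 𝒜 ⊗[R] (H ⊗[R] U.toSubmodule), ∀ k,
      normalBasisMap θinv S' (tensorEval 𝒜 (lam R H U.toSubmodule) s k) =
        sw (Δ (h * k)) fun y₁ y₂ => θinv (S' y₂) * (evalMap 𝒜 V t y₁ : B) := by
  induction t with
  | zero => exact ⟨0, by simp [sw]⟩
  | add t t' h h' =>
    obtain ⟨v, hv⟩ := h
    obtain ⟨v', hv'⟩ := h'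
    refine ⟨v + v', fun k => ?_⟩
    simp only [map_add, LinearMap.add_apply, hv, hv', Subalgebra.coe_add, mul_add, sw,
      Finset.sum_add_distrib]
  | tmul a g =>
    obtain ⟨u, hu⟩ := hRL.exists_lam hV g.2 h
    refine ⟨a ⊗ₜ u, fun k => ?_⟩
    rw [tensorEval_tmul, normalBasisMap_tmul, ← hu, rightHit_eq_sw]
    simp only [map_sw, map_smul, sw_mul, smul_mul_assoc, evalMap_tmul, Subalgebra.coe_smul,
      mul_smul_comm]

/-- The map `a ⊗ h ↦ a θ(h)`. -/
def leftBasisMap (θ : H →ₗ[R] B) : 𝒜 ⊗[R] H →ₗ[R] B :=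
  TensorProduct.lift (LinearMap.mk₂ R (fun (a : 𝒜) h => (a : B) * θ h)
      (by simp [add_mul]) (by simp) (by simp [mul_add]) (by simp))

@[simp] theorem leftBasisMap_tmul (h : H) (a : 𝒜) :
    leftBasisMap θ (a ⊗ₜ h) = a * θ h := rfl

theorem exists_tensorEval_phi (hinv : IsConvInverse θ θinv) (hS : IsTwistedAntipode R H S')
    (hRL : RLCondition R H V U.toSubmodule) (hV : IsRightSubmodule R H V)
    (hφ : ∀ (h : H) (a : 𝒜), ∃ t : 𝒜 ⊗[R] V, (𝒜).val.toLinearMap ∘ₗ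
        evalMap 𝒜 V t = phiTilde θ θinv S' h a) (h : H) (a : 𝒜) :
    ∃ s : 𝒜 ⊗[R] (H ⊗[R] U.toSubmodule), ∀ k,
      normalBasisMap θinv S' (tensorEval 𝒜 (lam R H U.toSubmodule) s k) =
        a * θ h * θinv (S' k) := by
  choose t ht using fun p => hφ p a
  choose s hs using fun p q =>
    exists_tensorEval_evalMap (θinv := θinv) (S' := S') hRL hV (t p) q
  refine ⟨sw (Δ h) s, fun k => ?_⟩
  have e : ∀ t, normalBasisMap θinv S' (tensorEval 𝒜 (lam R H U.toSubmodule) t k) =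
    (normalBasisMap θinv S' ∘ₗ LinearMap.applyₗ k ∘ₗ tensorEval 𝒜 (lam R H U.toSubmodule)) t :=
    fun _ => rfl
  have ht' : ∀ p y, (evalMap 𝒜 V (t p) y : B) = phiTilde θ θinv S' p a y := fun p y =>
    LinearMap.congr_fun (ht p) y
  rw [e, map_sw]
  simp only [← e, hs, ht']
  exact sw_sw_mul_phiTilde hinv hS h a k

/-- For u = h ⊗ g the right side is ∑ g(k₃) a θ(h k₂ S'(k₁)) = g(k) a θ(h). Coefficients are kept in
A ⊗ H, not just in B, so that they visibly lie in the span of the a θ(h). -/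
theorem exists_dualEval_lam (hS : IsTwistedAntipode R H S') (a : 𝒜)
    (u : H ⊗[R] U.toSubmodule) :
    ∃ s : (𝒜 ⊗[R] H) ⊗[R] U.toSubmodule, ∀ k,
      dualEval U.toSubmodule B (TensorProduct.comm R B _ ((leftBasisMap θ).rTensor _ s)) k =
        sw (Δ k) fun k₁ k₂ => a * θ (lam R H U.toSubmodule u k₂ * S' k₁) := by
  induction u with
  | zero => exact ⟨0, by simp [sw]⟩
  | add t t' h h' =>
    obtain ⟨v, hv⟩ := h
    obtain ⟨v', hv'⟩ := h'
    refine ⟨v + v', fun k => ?_⟩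
    simp only [map_add, LinearMap.add_apply, hv, hv', mul_add, add_mul, sw,
      Finset.sum_add_distrib]
  | tmul h g =>
    refine ⟨(a ⊗ₜ h) ⊗ₜ g, fun k => ?_⟩
    simp only [LinearMap.rTensor_tmul, TensorProduct.comm_tmul, leftBasisMap_tmul, dualEval_tmul, lam_tmul, leftHit_eq_sw,
      mul_sw, sw_mul, map_sw, mul_smul_comm, smul_mul_assoc, map_smul]
    rw [← sw_assoc k fun p q s => (g : Module.Dual R H) s • ((a : B) * θ (h * q * S' p))]
    have := hS.collapses_left.left k fun z s => (g : Module.Dual R H) s • ((a : B) * θ (h * z))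
    simpa only [mul_assoc, mul_one] using this.symm

theorem exists_dualEval_evalMap (hS : IsTwistedAntipode R H S')
    (hRL : RLCondition R H V U.toSubmodule)
    (hV : IsRightSubmodule R H V) (t : 𝒜 ⊗[R] V) (h : H) :
    ∃ s : (𝒜 ⊗[R] H) ⊗[R] U.toSubmodule, ∀ k,
      dualEval U.toSubmodule B (TensorProduct.comm R B _ ((leftBasisMap θ).rTensor _ s)) k =
        sw (Δ k) fun k₁ k₂ => sw (Δ (h * k₂)) fun y₁ y₂ =>
          (evalMap 𝒜 V t y₁ : B) * θ (y₂ * S' k₁) := by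
  induction t with
  | zero => exact ⟨0, by simp [sw]⟩
  | add t t' h h' =>
    obtain ⟨v, hv⟩ := h
    obtain ⟨v', hv'⟩ := h'
    refine ⟨v + v', fun k => ?_⟩
    simp only [map_add, LinearMap.add_apply, hv, hv', Subalgebra.coe_add, add_mul, sw,
      Finset.sum_add_distrib]
  | tmul a g =>
    obtain ⟨u, hu⟩ := hRL.exists_lam hV g.2 h
    obtain ⟨s, hs⟩ := exists_dualEval_lam (θ := θ) hS a u
    refine ⟨s, fun k => ?_⟩
    rw [hs]
    simp only [← hu, rightHit_eq_sw, map_sw, map_smul, sw_mul, mul_sw, smul_mul_assoc,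
      evalMap_tmul, Subalgebra.coe_smul, mul_smul_comm]

theorem exists_dualEval_psi (hinv : IsConvInverse θ θinv) (hS : IsTwistedAntipode R H S')
    (hRL : RLCondition R H V U.toSubmodule) (hV : IsRightSubmodule R H V)
    (hψ : ∀ (h : H) (a : 𝒜), ∃ t : 𝒜 ⊗[R] V, (𝒜).val.toLinearMap ∘ₗ
        evalMap 𝒜 V t = psiTilde θ θinv S' h a) (h : H) (a : 𝒜) :
    ∃ s : (𝒜 ⊗[R] H) ⊗[R] U.toSubmodule, ∀ k,
      dualEval U.toSubmodule B (TensorProduct.comm R B _ ((leftBasisMap θ).rTensor _ s)) k =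
        sw (Δ k) fun k₁ k₂ => θinv (S' (h * k₂)) * a * θ (S' k₁) := by
  choose t ht using fun p => hψ p a
  choose s hs using fun p q => exists_dualEval_evalMap (θ := θ) hS hRL hV (t p) q
  refine ⟨sw (Δ h) s, fun k => ?_⟩
  have e : ∀ t, dualEval U.toSubmodule B
      (TensorProduct.comm R B _ ((leftBasisMap θ).rTensor _ t)) k =
    (LinearMap.applyₗ k ∘ₗ dualEval U.toSubmodule B ∘ₗ
      (TensorProduct.comm R B _).toLinearMap ∘ₗ (leftBasisMap θ).rTensor _) t :=
    fun _ => rfl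
  have ht' : ∀ p y, (evalMap 𝒜 V (t p) y : B) = psiTilde θ θinv S' p a y := fun p y =>
    LinearMap.congr_fun (ht p) y
  rw [e, map_sw]
  simp only [← e, hs, ht']
  exact sw_sw_psiTilde_mul hinv hS h a k

/-- By the normal basis it suffices to reach η(h) a, and this is the value at k = 1 of the
expression in `exists_dualEval_psi`. -/
theorem leftBasisMap_surjective (hθ : IsTotalIntegral θ) (hinv : IsConvInverse θ θinv)
    (hS : IsTwistedAntipode R H S')
    (hRL : RLCondition R H V U.toSubmodule) (hV : IsRightSubmodule R H V)
    (hψ : ∀ (h : H) (a : 𝒜), ∃ t : 𝒜 ⊗[R] V, (𝒜).val.toLinearMap ∘ₗ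
        evalMap 𝒜 V t = psiTilde θ θinv S' h a) :
    Function.Surjective (leftBasisMap θ : 𝒜 ⊗[R] H →ₗ[R] B) := by
  rw [← LinearMap.range_eq_top, eq_top_iff]
  rintro b -
  obtain ⟨t, rfl⟩ := (normalBasisMap_bijective hθ hinv hS).2 b
  induction t with
  | zero => simp
  | add t t' h h' => rw [map_add]; exact Submodule.add_mem _ h h'
  | tmul h a =>
    obtain ⟨s, hs⟩ := exists_dualEval_psi hinv hS hRL hV hψ h a
    have := hs 1
    rw [sw_one, hS.map_one, hθ.map_one, mul_one, mul_one] at this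
    rw [normalBasisMap_tmul, ← this]
    clear this hs
    induction s with
    | zero => simp
    | add t t' h h' => simp only [map_add, LinearMap.add_apply]; exact Submodule.add_mem _ h h'
    | tmul t f => exact Submodule.smul_mem _ _ ⟨t, rfl⟩

/-- Reversed convolution of `exists_dualEval_psi` with η removes the factor θ(S'(k₁)). -/
theorem exists_smashEval_psi (hinv : IsConvInverse θ θinv) (hS : IsTwistedAntipode R H S')
    (hRL : RLCondition R H V U.toSubmodule) (hV : IsRightSubmodule R H V)
    (hψ : ∀ (h : H) (a : 𝒜), ∃ t : 𝒜 ⊗[R] V, (𝒜).val.toLinearMap ∘ₗ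
        evalMap 𝒜 V t = psiTilde θ θinv S' h a) (h : H) (a : 𝒜) :
    ∃ s : B ⊗[R] U.toSubmodule, ∀ k,
      smashEval (θinv ∘ₗ S') U.toSubmodule s k = θinv (S' (h * k)) * a := by
  obtain ⟨s, hs⟩ := exists_dualEval_psi hinv hS hRL hV hψ h a
  refine ⟨(leftBasisMap θ).rTensor _ s, fun k =>
    (sw_dualEval_mul (θinv ∘ₗ S') _ k).symm.trans ?_⟩
  simp only [hs, sw_mul, LinearMap.comp_apply]
  rw [← sw_assoc k fun k₁ p q => θinv (S' (h * q)) * a * θ (S' p) * θinv (S' k₁)]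
  have := (hinv.collapses_right.comp_twistedAntipode hS).left k
    fun z q => θinv (S' (h * q)) * a * z
  simpa only [mul_assoc, mul_one] using this

/-- Both images are stable under precomposition with f ⇀ for f ∈ U, because U is closed under
convolution. It remains to treat k ↦ a θ(h) η(k), as the a θ(h) span B, and k ↦ η(hk) a. -/
theorem range_smashEval (hθ : IsTotalIntegral θ) (hinv : IsConvInverse θ θinv)
    (hS : IsTwistedAntipode R H S')
    (hRL : RLCondition R H V U.toSubmodule) (hV : IsRightSubmodule R H V)
    (hφ : ∀ (h : H) (a : 𝒜), ∃ t : 𝒜 ⊗[R] V, (𝒜).val.toLinearMap ∘ₗ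
        evalMap 𝒜 V t = phiTilde θ θinv S' h a)
    (hψ : ∀ (h : H) (a : 𝒜), ∃ t : 𝒜 ⊗[R] V, (𝒜).val.toLinearMap ∘ₗ
        evalMap 𝒜 V t = psiTilde θ θinv S' h a) :
    LinearMap.range (smashEval (θinv ∘ₗ S') U.toSubmodule) =
      LinearMap.range ((normalBasisMap θinv S').compRight R ∘ₗ
        tensorEval 𝒜 (lam R H U.toSubmodule)) := by
  apply le_antisymm
  · rintro _ ⟨t, rfl⟩
    induction t with
    | zero => simp
    | add t t' h h' => rw [map_add]; exact Submodule.add_mem _ h h'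
    | tmul b f =>
      obtain ⟨z, rfl⟩ := leftBasisMap_surjective hθ hinv hS hRL hV hψ b
      induction z with
      | zero => simp
      | add t t' h h' =>
        rw [map_add, TensorProduct.add_tmul, map_add]
        exact Submodule.add_mem _ h h'
      | tmul a h =>
        obtain ⟨s, hs⟩ := exists_tensorEval_phi hinv hS hRL hV hφ h a
        obtain ⟨s', hs'⟩ := tensorEval_leftHit s f
        refine ⟨s', LinearMap.ext fun k => ?_⟩
        change normalBasisMap θinv S' (tensorEval 𝒜 (lam R H U.toSubmodule) s' k) = _
        rw [← hs', hs]
        rfl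
  · rintro _ ⟨t, rfl⟩
    induction t with
    | zero => simp
    | add t t' h h' => rw [map_add]; exact Submodule.add_mem _ h h'
    | tmul a u =>
      induction u with
      | zero => simp
      | add t t' h h' =>
        rw [TensorProduct.tmul_add, map_add]
        exact Submodule.add_mem _ h h'
      | tmul h f =>
        obtain ⟨s, hs⟩ := exists_smashEval_psi hinv hS hRL hV hψ h a
        obtain ⟨s', hs'⟩ := smashEval_leftHit (θinv ∘ₗ S') s f
        refine ⟨s', LinearMap.ext fun k => ?_⟩
        rw [← hs', hs]
        rfl

end Range

/-! ### The two actions and the construction of the algebra isomorphism. -/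

section Representation

variable {R H B : Type*} [CommRing R] [Ring H] [Bialgebra R H] [Ring B] [Algebra R B]
  [RightComoduleAlgebra R H B] {θ θinv : H →ₗ[R] B} {S' : H →ₗ[R] H}
  {U : ModuleSubalgebra R H}

local notation "Δ" => Coalgebra.comul (R := R)
local notation "ε" => Coalgebra.counit (R := R)
local notation "ϱ" => RightComoduleAlgebra.coaction (R := R) (H := H)
local notation "𝒜" => coinvariants R H B

/-- `f ⇀ b = ∑ b₀ f(b₁)`. -/
def coactionHit (B : Type*) [Ring B] [Algebra R B] [RightComoduleAlgebra R H B] :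
    Module.Dual R H →ₗ[R] Module.End R B where
  toFun f := (TensorProduct.rid R B).toLinearMap ∘ₗ f.lTensor B ∘ₗ (ϱ).toLinearMap
  map_add' f g := by simp [LinearMap.lTensor_add, LinearMap.add_comp, LinearMap.comp_add]
  map_smul' c f := by simp [LinearMap.lTensor_smul, LinearMap.smul_comp, LinearMap.comp_smul]

theorem coactionHit_eq_sw (f : Module.Dual R H) (b : B) :
    coactionHit B f b = sw (ϱ b) fun x y => f y • x :=
  (sw_apply ((TensorProduct.rid R B).toLinearMap ∘ₗ f.lTensor B) (ϱ b)).symm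

theorem coactionHit_coactionHit (g f : Module.Dual R H) (b : B) :
    coactionHit B g (coactionHit B f b) = coactionHit B (conv R H g f) b := by
  rw [coactionHit_eq_sw f]
  simp only [map_sw, map_smul]
  simp only [coactionHit_eq_sw, conv_eq_sw, smul_sw, sw_smul]
  rw [sw_coaction_assoc b fun p q r => f r • g q • p]
  simp only [smul_smul, mul_comm]

theorem coactionHit_mul (f : Module.Dual R H) (b c : B) :
    coactionHit B f (b * c) = sw (ϱ b) fun x y => x * coactionHit B (regAct R H f y) c := by
  simp only [coactionHit_eq_sw, map_mul, mul_sw, regAct_apply, mul_smul_comm]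
  rw [sw_tmul_mul]

/-- η is colinear and a is coinvariant, so f ⇀ passes through to k. -/
theorem coactionHit_basis (hθ : IsTotalIntegral θ) (hinv : IsConvInverse θ θinv)
    (hS : IsTwistedAntipode R H S') (f : Module.Dual R H) (k : H) (a : 𝒜) :
    coactionHit B f (θinv (S' k) * a) = θinv (S' (leftHit R H f k)) * a := by
  rw [coactionHit_eq_sw, sw_coaction_mul hθ hinv hS, leftHit_eq_sw]
  simp only [map_sw, map_smul, sw_mul, smul_mul_assoc]

/-- The action of `B # U` on `B`, `(b # f) c = b (f ⇀ c)`. -/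
def smashRep : Smash R H B U →ₗ[R] Module.End R B :=
  TensorProduct.lift ((LinearMap.mul R (Module.End R B)).compl₁₂ (LinearMap.mul R B)
    (coactionHit B ∘ₗ U.toSubmodule.subtype))

theorem smashRep_mk (b : B) (f : U.toSubmodule) (c : B) :
    smashRep (Smash.mk b f) c = b * coactionHit B f.1 c := rfl

theorem Smash.induction {P : Smash R H B U → Prop} (zero : P 0)
    (mk : ∀ b f, P (Smash.mk b f)) (add : ∀ x y, P x → P y → P (x + y)) (x : Smash R H B U) :
    P x := TensorProduct.induction_on x zero mk add

theorem Smash.mk_mul_mk_eq_sw (b b' : B) (f f' : U.toSubmodule) :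
    (Smash.mk b f * Smash.mk b' f' : Smash R H B U) =
      sw (ϱ b') fun x y => Smash.mk (b * x) (twistConv R H U f y f') :=
  Smash.mk_mul_mk R H B U b b' f f' _ Prod.fst Prod.snd (sw_tmul_self (ϱ b')).symm

theorem smashRep_mul (x y : Smash R H B U) : smashRep (x * y) = smashRep x * smashRep y := by
  induction x using Smash.induction with
  | zero => simp
  | add x x' h h' => simp only [add_mul, map_add, h, h']
  | mk b f =>
    induction y using Smash.induction with
    | zero => simp
    | add x x' h h' => simp only [mul_add, map_add, h, h']
    | mk b' f' =>
      ext c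
      rw [Smash.mk_mul_mk_eq_sw]
      have e : ∀ t : Smash R H B U, smashRep t c = (LinearMap.applyₗ c ∘ₗ smashRep) t :=
        fun _ => rfl
      rw [e, map_sw]
      simp only [← e, Module.End.mul_apply, smashRep_mk, coactionHit_mul, mul_sw,
        coactionHit_coactionHit, mul_assoc]
      rfl

/-- `lam` as a map on `H # U`. -/
def Smash.lam (U : ModuleSubalgebra R H) : Smash R H H U →ₗ[R] Module.End R H :=
  CleftDuality.lam R H U.toSubmodule

/-- For B = H the representation `smashRep` is λ by definition. -/
theorem Smash.lam_mul (x y : Smash R H H U) :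
    Smash.lam U (x * y) = Smash.lam U x * Smash.lam U y :=
  smashRep_mul x y

/-- `smashEval` as a map on `B # U`. -/
def Smash.eval (η : H →ₗ[R] B) : Smash R H B U →ₗ[R] H →ₗ[R] B := smashEval η U.toSubmodule

theorem smashRep_basis (hθ : IsTotalIntegral θ) (hinv : IsConvInverse θ θinv)
    (hS : IsTwistedAntipode R H S') (x : Smash R H B U) (k : H) (a : 𝒜) :
    smashRep x (normalBasisMap θinv S' (k ⊗ₜ a)) =
      Smash.eval (θinv ∘ₗ S') x k * a := by
  induction x using Smash.induction with
  | zero => simp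
  | add x x' h h' => simp only [map_add, LinearMap.add_apply, h, h', add_mul]
  | mk b f =>
    rw [smashRep_mk, normalBasisMap_tmul, coactionHit_basis hθ hinv hS, ← mul_assoc]
    rfl

/-- The action of `A ⊗ X` on `H ⊗ A` for an algebra `X` that acts on `H`. -/
def tensorRep {X : Type*} [AddCommMonoid X] [Module R X] (A : Type*) [Ring A] [Algebra R A]
    (Λ : X →ₗ[R] Module.End R H) : A ⊗[R] X →ₗ[R] Module.End R (H ⊗[R] A) :=
  TensorProduct.lift ((TensorProduct.mapBilinear (.id R) H A H A).flip.compl₁₂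
    (LinearMap.mul R A) Λ)

@[simp] theorem tensorRep_tmul {X A : Type*} [AddCommMonoid X] [Module R X] [Ring A] [Algebra R A]
    (Λ : X →ₗ[R] Module.End R H) (a a' : A) (x : X) (k : H) :
    tensorRep A Λ (a ⊗ₜ x) (k ⊗ₜ a') = Λ x k ⊗ₜ (a * a') := rfl

theorem tensorRep_mul {X A : Type*} [NonUnitalNonAssocSemiring X] [Module R X] [IsScalarTower R X X]
    [SMulCommClass R X X] [Ring A] [Algebra R A] {Λ : X →ₗ[R] Module.End R H}
    (hΛ : ∀ x y, Λ (x * y) = Λ x * Λ y) (s t : A ⊗[R] X) :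
    tensorRep A Λ (s * t) = tensorRep A Λ s * tensorRep A Λ t := by
  induction s with
  | zero => simp
  | add x x' h h' => simp only [add_mul, map_add, h, h']
  | tmul a x =>
    induction t with
    | zero => simp
    | add x x' h h' => simp only [mul_add, map_add, h, h']
    | tmul a' x' =>
      ext k c
      simp [Algebra.TensorProduct.tmul_mul_tmul, hΛ, mul_assoc]

theorem normalBasisMap_tensorRep {X : Type*} [AddCommMonoid X] [Module R X]
    (Λ : X →ₗ[R] Module.End R H) (t : 𝒜 ⊗[R] X) (k : H) (a : 𝒜) :
    normalBasisMap θinv S' (tensorRep 𝒜 Λ t (k ⊗ₜ a)) =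
      normalBasisMap θinv S' (tensorEval 𝒜 Λ t k) * a := by
  induction t with
  | zero => simp
  | add x x' h h' => simp only [map_add, LinearMap.add_apply, h, h', add_mul]
  | tmul b x => simp [mul_assoc]

/-- X is kept abstract to cover both H # U and its image in End(H). Injectivity of Λ itself is not
required, only that of `tensorEval`. -/
theorem exists_nonUnitalAlgHom (hθ : IsTotalIntegral θ) (hinv : IsConvInverse θ θinv)
    (hS : IsTwistedAntipode R H S')
    {X : Type*} [NonUnitalNonAssocSemiring X] [Module R X] [IsScalarTower R X X]
    [SMulCommClass R X X] {Λ : X →ₗ[R] Module.End R H}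
    (hΛ : ∀ x y, Λ (x * y) = Λ x * Λ y) (hinj : Function.Injective (tensorEval 𝒜 Λ))
    (hinj' : Function.Injective (Smash.eval (U := U) (θinv ∘ₗ S')))
    (hrange : LinearMap.range (Smash.eval (U := U) (θinv ∘ₗ S')) =
      LinearMap.range ((normalBasisMap θinv S').compRight R ∘ₗ tensorEval 𝒜 Λ)) :
    ∃ e : Smash R H B U →ₙₐ[R] 𝒜 ⊗[R] X, Function.Bijective e ∧
      ∀ (hε : ε ∈ U.toSubmodule) (x : X), Λ x = 1 → e (Smash.mk 1 ⟨ε, hε⟩) = 1 ⊗ₜ x := by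
  set Ψ := (normalBasisMap θinv S').compRight R ∘ₗ tensorEval 𝒜 Λ with hΨ
  have hΨ_inj : Function.Injective Ψ := by
    intro s t hst
    refine hinj (LinearMap.ext fun k => (normalBasisMap_bijective hθ hinv hS).1 ?_)
    exact LinearMap.congr_fun hst k
  let e : Smash R H B U ≃ₗ[R] 𝒜 ⊗[R] X :=
    (LinearEquiv.ofInjective (Smash.eval (U := U) (θinv ∘ₗ S')) hinj').trans
      ((LinearEquiv.ofEq _ _ hrange).trans (LinearEquiv.ofInjective Ψ hΨ_inj).symm)
  have he : ∀ x, Ψ (e x) = Smash.eval (θinv ∘ₗ S') x := by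
    intro x
    have := LinearEquiv.apply_symm_apply (LinearEquiv.ofInjective Ψ hΨ_inj)
      (LinearEquiv.ofEq _ _ hrange
        (LinearEquiv.ofInjective (Smash.eval (U := U) (θinv ∘ₗ S')) hinj' x))
    exact congrArg Subtype.val this
  -- Agreement on the elements k ⊗ 1 extends to H ⊗ A by right A-linearity; multiplicativity of e
  -- then follows from that of the two actions.
  have hcomm : ∀ x, smashRep x ∘ₗ normalBasisMap θinv S' =
      normalBasisMap θinv S' ∘ₗ tensorRep 𝒜 Λ (e x) := by
    intro x
    refine TensorProduct.ext' fun k a => ?_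
    rw [LinearMap.comp_apply, LinearMap.comp_apply, smashRep_basis hθ hinv hS,
      normalBasisMap_tensorRep, ← he]
    rfl
  have hval : ∀ (x : Smash R H B U) k, Smash.eval (θinv ∘ₗ S') x k =
      smashRep x (normalBasisMap θinv S' (k ⊗ₜ (1 : 𝒜))) := by
    intro x k
    rw [smashRep_basis hθ hinv hS, OneMemClass.coe_one, mul_one]
  have hmul : ∀ x y, e (x * y) = e x * e y := by
    intro x y
    refine hΨ_inj (LinearMap.ext fun k => ?_)
    have h₁ : Ψ (e x * e y) k =
        normalBasisMap θinv S' (tensorRep 𝒜 Λ (e x * e y) (k ⊗ₜ (1 : 𝒜))) := by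
      rw [normalBasisMap_tensorRep, OneMemClass.coe_one, mul_one]
      rfl
    have h₂ := LinearMap.congr_fun (hcomm x) (tensorRep 𝒜 Λ (e y) (k ⊗ₜ (1 : 𝒜)))
    have h₃ := LinearMap.congr_fun (hcomm y) (k ⊗ₜ (1 : 𝒜))
    simp only [LinearMap.comp_apply] at h₂ h₃
    rw [he, hval, h₁, smashRep_mul, tensorRep_mul hΛ, Module.End.mul_apply, Module.End.mul_apply,
      h₃, h₂]
  refine ⟨{
    toFun := e
    map_smul' := e.map_smul
    map_zero' := e.map_zero
    map_add' := e.map_add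
    map_mul' := hmul }, e.bijective, fun hε x hx => hΨ_inj (LinearMap.ext fun k => ?_)⟩
  refine (LinearMap.congr_fun (he _) k).trans ?_
  change (1 : B) * θinv (S' (leftHit R H ε k)) = θinv (S' (Λ x k)) * ((1 : 𝒜) : B)
  rw [leftHit_counit, hx, OneMemClass.coe_one, one_mul, mul_one]
  rfl

end Representation

/-! ### Density of λ(H # U) in End(H). -/

section Density

variable {R H : Type*} [CommRing R] [Ring H] [Bialgebra R H] {S' : H →ₗ[R] H}
  {U : ModuleSubalgebra R H}

local notation "Δ" => Coalgebra.comul (R := R)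

/-- The image of `λ : H # U → End(H)`. -/
def lamRange (U : ModuleSubalgebra R H) : NonUnitalSubalgebra R (Module.End R H) :=
  { LinearMap.range (lam R H U.toSubmodule) with
    mul_mem' := by
      rintro _ _ ⟨x, rfl⟩ ⟨y, rfl⟩
      exact ⟨_, Smash.lam_mul (U := U) x y⟩ }

theorem isDenseIn_lamRange (hS : IsTwistedAntipode R H S') [Module.Projective R H]
    (hU : IsDenseIn (U.toSubmodule : Set (Module.Dual R H)) Set.univ) :
    IsDenseIn (lamRange U : Set (Module.End R H)) Set.univ := by
  classical
  refine ⟨Set.subset_univ _, fun E _ F => ?_⟩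
  obtain ⟨s, hs⟩ := Module.Projective.out (R := R) (P := H)
  -- Q is the reversed convolution of E with S', so that E(k) = ∑ Q(k₂) k₁. Approximating Q by ∑ u i
  -- (·) i with u i ∈ U therefore approximates E by ∑ i (u i ⇀ k).
  let Q : H →ₗ[R] H :=
    (show IsLinearMap R fun k => sw (Δ k) fun x y => E y * S' x by fun_prop).mk'
  have hQ : ∀ k, (sw (Δ k) fun x y => Q y * x) = E k := by
    intro k
    change (sw (Δ k) fun x y => (sw (Δ y) fun p q => E q * S' p) * x) = E k
    simp only [sw_mul]
    rw [← sw_assoc k fun x p q => E q * S' p * x]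
    have := hS.collapses_right.left k fun z q => E q * z
    simpa only [mul_assoc, mul_one] using this
  -- P collects the second legs of Δ(k) for k ∈ F, the only points where Q is evaluated; I collects
  -- the dual basis indices needed to expand Q there.
  let P : Finset H := F.biUnion fun k => (TensorProduct.exists_finset (Δ k)).choose.image Prod.snd
  let I : Finset H := P.biUnion fun y => (s (Q y)).support
  have hc : ∀ i : H, ∃ u ∈ U.toSubmodule, ∀ y ∈ P, u y = s (Q y) i := fun i =>
    hU.2 (Finsupp.lapply i ∘ₗ s ∘ₗ Q) trivial P
  choose u hu hus using hc
  refine ⟨∑ i ∈ I, lam R H U.toSubmodule (i ⊗ₜ ⟨u i, hu i⟩),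
    ⟨∑ i ∈ I, i ⊗ₜ ⟨u i, hu i⟩, map_sum _ _ _⟩, fun k hk => ?_⟩
  have hexp : ∀ y ∈ P, Q y = ∑ i ∈ I, s (Q y) i • i := by
    intro y hy
    conv_lhs => rw [← hs (Q y), Finsupp.linearCombination_apply, Finsupp.sum]
    refine Finset.sum_subset (Finset.subset_biUnion_of_mem (fun y => (s (Q y)).support) hy) ?_
    intro i _ hi
    rw [Finsupp.notMem_support_iff.1 hi, zero_smul]
  rw [← hQ, LinearMap.sum_apply]
  simp only [lam_tmul, leftHit_eq_sw, sw, Finset.mul_sum]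
  rw [Finset.sum_comm]
  refine Finset.sum_congr rfl fun p hp => ?_
  have hpP : p.2 ∈ P := Finset.mem_biUnion.2 ⟨k, hk, Finset.mem_image_of_mem _ hp⟩
  rw [hexp p.2 hpP, Finset.sum_mul]
  refine Finset.sum_congr rfl fun i _ => ?_
  rw [hus i p.2 hpP, mul_smul_comm, smul_mul_assoc]

end Density

/-! ### Passing from H # U to its image under λ. -/

section Inclusion

variable {R H : Type*} [CommRing R] [Ring H] [Bialgebra R H] {U : ModuleSubalgebra R H}
  {A : Type*} [AddCommGroup A] [Module R A]

/-- `λ` as a map onto its image. -/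
def lamToRange (U : ModuleSubalgebra R H) : H ⊗[R] U.toSubmodule →ₗ[R] lamRange U :=
  (lam R H U.toSubmodule).rangeRestrict

/-- The inclusion of the image of `λ` into `End(H)`. -/
def lamRangeSubtype (U : ModuleSubalgebra R H) : lamRange U →ₗ[R] Module.End R H :=
  (LinearMap.range (lam R H U.toSubmodule)).subtype

theorem tensorEval_lamToRange (A : Type*) [AddCommGroup A] [Module R A] :
    tensorEval A (lam R H U.toSubmodule) =
      tensorEval A (lamRangeSubtype U) ∘ₗ (lamToRange U).lTensor A := by
  refine TensorProduct.ext' fun a x => ?_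
  rfl

theorem lTensor_lamToRange_surjective (A : Type*) [AddCommGroup A] [Module R A] :
    Function.Surjective ((lamToRange U).lTensor A) :=
  LinearMap.lTensor_surjective A (LinearMap.surjective_rangeRestrict _)

/-- A ⊗ (H ⊗ U) maps onto A ⊗ λ(H # U), and the composite into Hom(H, H ⊗ A) is injective, so its
second factor is injective as well. No flatness of A is needed. -/
theorem tensorEval_lamRangeSubtype_injective
    (h : Function.Injective (tensorEval A (lam R H U.toSubmodule))) :
    Function.Injective (tensorEval A (lamRangeSubtype U)) := by
  rw [tensorEval_lamToRange, LinearMap.coe_comp] at h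
  intro x y hxy
  obtain ⟨x, rfl⟩ := lTensor_lamToRange_surjective A x
  obtain ⟨y, rfl⟩ := lTensor_lamToRange_surjective A y
  exact congrArg _ (h hxy)

theorem range_tensorEval_lamRangeSubtype {M : Type*} [AddCommGroup M] [Module R M]
    (ω : H ⊗[R] A →ₗ[R] M) :
    LinearMap.range (ω.compRight R ∘ₗ tensorEval A (lam R H U.toSubmodule)) =
      LinearMap.range (ω.compRight R ∘ₗ tensorEval A (lamRangeSubtype U)) := by
  rw [tensorEval_lamToRange, ← LinearMap.comp_assoc, LinearMap.range_comp_of_range_eq_top]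
  exact LinearMap.range_eq_top.2 (lTensor_lamToRange_surjective A)

end Inclusion

end CleftDuality

end

/-! ### The main theorem. -/

open CleftDuality in
theorem mainTheorem7 {R : Type*} {H : Type*} {B : Type*} [CommRing R] [IsNoetherianRing R]
    [Ring H] [HopfAlgebra R H] [Ring B] [Algebra R B] [RightComoduleAlgebra R H B]
    (S' : H →ₗ[R] H) (hS' : IsTwistedAntipode R H S')
    (θ θinv : H →ₗ[R] B) (hθ : IsTotalIntegral θ) (hθinv : IsConvInverse θ θinv)
    (U : ModuleSubalgebra R H)
    (V : Submodule R (Module.Dual R H)) (hV : IsRightSubmodule R H V)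
    (hφ : ∀ (h : H) (a : coinvariants R H B),
      ∃ t : coinvariants R H B ⊗[R] V, (coinvariants R H B).val.toLinearMap ∘ₗ
        evalMap (coinvariants R H B) V t = phiTilde θ θinv S' h a)
    (hψ : ∀ (h : H) (a : coinvariants R H B),
      ∃ t : coinvariants R H B ⊗[R] V, (coinvariants R H B).val.toLinearMap ∘ₗ
        evalMap (coinvariants R H B) V t = psiTilde θ θinv S' h a)
    (hRL : RLCondition R H V U.toSubmodule) :
    -- purity gives `B # U ≃ A ⊗ (H # U)`
    (IsPureFor (coinvariants R H B ⊗[R] H) (asFunctions U.toSubmodule) →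
      ∃ e : Smash R H B U →ₙₐ[R] coinvariants R H B ⊗[R] Smash R H H U,
        Function.Bijective e ∧
        ∀ hε : Coalgebra.counit ∈ U.toSubmodule,
          e (Smash.mk 1 ⟨Coalgebra.counit, hε⟩) = 1 ⊗ₜ Smash.mk 1 ⟨Coalgebra.counit, hε⟩) ∧
    -- if moreover `H` is projective and `U ⊆ H^*` is dense, then `B # U ≃ A ⊗ L`
    (IsPureFor (coinvariants R H B ⊗[R] H) (asFunctions U.toSubmodule) →
      Module.Projective R H →
      IsDenseIn (U.toSubmodule : Set (Module.Dual R H)) Set.univ →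
      ∃ L : NonUnitalSubalgebra R (Module.End R H),
        IsDenseIn (L : Set (Module.End R H)) Set.univ ∧
        ∃ e : Smash R H B U →ₙₐ[R] coinvariants R H B ⊗[R] L,
          Function.Bijective e ∧
          ∀ hε : Coalgebra.counit ∈ U.toSubmodule, ∃ hL : (1 : Module.End R H) ∈ L,
            e (Smash.mk 1 ⟨Coalgebra.counit, hε⟩) = 1 ⊗ₜ ⟨1, hL⟩) ∧
    -- the purity hypothesis holds for subbialgebras of `H°` if `H` is a Hopf `α`-algebra
    (IsAlphaAlgebra R H → IsSubbialgebra R H U →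
      IsPureFor (coinvariants R H B ⊗[R] H) (asFunctions U.toSubmodule)) ∧
    -- the density hypothesis holds if `R` is QF, `H` residually finite and `U ⊆ H°` dense
    (IsQuasiFrobenius R → IsResiduallyFinite R H →
      IsDenseIn (U.toSubmodule : Set (Module.Dual R H)) (finiteDual R H) →
      IsDenseIn (U.toSubmodule : Set (Module.Dual R H)) Set.univ) := by
  have hrange := range_smashEval hθ hθinv hS' hRL hV hφ hψ
  have hinj : IsPureFor (coinvariants R H B ⊗[R] H) (asFunctions U.toSubmodule) →
      Function.Injective (tensorEval (coinvariants R H B) (lam R H U.toSubmodule)) := fun h =>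
    tensorEval_lam_injective hS' (dualEval_injective
      (isPureFor_congr (TensorProduct.comm R (coinvariants R H B) H) h))
  have hinj' : IsPureFor (coinvariants R H B ⊗[R] H) (asFunctions U.toSubmodule) →
      Function.Injective (Smash.eval (U := U) (θinv ∘ₗ S')) := fun h =>
    smashEval_injective (ζ := θ ∘ₗ S') (hθinv.collapses_left.comp_twistedAntipode hS') (dualEval_injective
      -- Purity is assumed for A ⊗ H but needed for B; the normal basis isomorphism transports it.
      (isPureFor_congr ((TensorProduct.comm R (coinvariants R H B) H).trans
        (LinearEquiv.ofBijective _ (normalBasisMap_bijective hθ hθinv hS'))) h))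
  refine ⟨fun h => ?_, fun h hP hU => ?_, fun hH hU => hU.isPureFor hH _, fun hR hH hU =>
    isDenseIn_univ_of_isQuasiFrobenius hR hH hU⟩
  · obtain ⟨e, he, he'⟩ := exists_nonUnitalAlgHom hθ hθinv hS' (X := Smash R H H U)
      (Λ := Smash.lam U) Smash.lam_mul (hinj h) (hinj' h) hrange
    refine ⟨e, he, fun hε => he' hε _ (LinearMap.ext fun k => ?_)⟩
    exact (one_mul _).trans (leftHit_counit k)
  · obtain ⟨e, he, he'⟩ := exists_nonUnitalAlgHom hθ hθinv hS' (X := lamRange U)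
      (Λ := lamRangeSubtype U) (fun _ _ => rfl)
      (tensorEval_lamRangeSubtype_injective (hinj h)) (hinj' h)
      (hrange.trans (range_tensorEval_lamRangeSubtype _))
    refine ⟨lamRange U, isDenseIn_lamRange hS' hU, e, he, fun hε =>
      ⟨⟨1 ⊗ₜ ⟨_, hε⟩, LinearMap.ext fun k => (one_mul _).trans (leftHit_counit k)⟩,
        he' hε _ rfl⟩⟩
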